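/- Let $(\Omega,\mathscr A,\mathbb P)$ be a probability space, let $\xi_0,\xi_1,\dots$ be a strictly stationary sequence of random elements of the space $M_1(\mathbb R)$ of Borel probability measures on $\mathbb R$, put $\Xi=\sigma(\xi_0,\xi_1,\dots)$, and let $(X_\tau)_{\tau\ge 0}$ be real random variables such that $\mathbb P[X_\tau\in B\mid\Xi]=\xi_t(B)$ almost surely for every Borel set $B$, every $t\in\{0,1,\dots\}$ and every $\tau\in[t,t+1)$ (a conjugate process). Assume that it is cyclic-independent: conditionally on $\Xi$, the processes $(X_\tau)_{\tau\in[t,t+1)}$, $t=0,1,\dots$, are independent; and that $n^{-1}\sum_{t=1}^n\xi_t\to\mathbb E\xi_0$ in probability (for the weak topology), where $\mathbb E\xi_0(B)=\mathbb E(\xi_0(B))$. Let $\mu$ be a finite Borel measure on $\mathbb R$ that is equivalent to Lebesgue measure on some interval containing the support of $\mathbb E\xi_0$; $\langle\cdot,\cdot\rangle$ and $\|\cdot\|$ are those of $L^2(\mu)$. Let $F_t(x)=\xi_t(-\infty,x]$ and $C_k(x,y)=\mathrm{Cov}(F_0(x),F_k(y))$. Fix an integer $p\ge1$, let $R(x,y)=\sum_{k=1}^p\int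 C_k(x,z)C_k(y,z)\,\mu(dz)$, and let $C_0^\mu$, $R^\mu$ be the integral operators on $L^2(\mu)$ with kernels $C_0$, $R$. Assume that $R^\mu$ and $C_0^\mu$ have ranges with the same closure, and that $d:=\mathrm{rank}(C_0^\mu)=1$. Let $\psi_1$ be a unit eigenfunction of $R^\mu$ for its largest eigenvalue. For each $t\ge1$ let $q_t\ge1$, let $\tau_{1t},\dots,\tau_{q_tt}\in[t,t+1)$ be (deterministic) times, and put $X_{it}=X_{\tau_{it}}$, $\widehat F_t(x)=q_t^{-1}\sum_{i=1}^{q_t}\mathbb I_{[X_{it}\le x]}$ and $\varepsilon_t=\widehat F_t-F_t$. For $n>p$ put $\widehat{\mathbb E}F_0=n^{-1}\sum_{t=1}^n\widehat F_t$, $$\widehat C_k(x,y)=\frac1{n-p}\sum_{t=1}^{n-p}\big(\widehat F_t(x)-\widehat{\mathbb E}F_0(x)\big)\big(\widehat F_{t+k}(y)-\widehat{\mathbb E}F_0(y)\big),$$ $\widehat R(x,y)=\sum_{k=1}^p\int\widehat C_k(x,z)\widehat C_k(y,z)\,\mu(dz)$; let $\widehat\psi_1$ be a unit eigenfunction, for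 the largest eigenvalue, of the integral operator $\widehat R^\mu$ with kernel $\widehat R$, put $\widehat W_{t1}=\langle\widehat F_t-\widehat{\mathbb E}F_0,\widehat\psi_1\rangle$ and consider the estimator (with $\widehat d=1$) $\widetilde F_t=\widehat{\mathbb E}F_0+\widehat W_{t1}\widehat\psi_1$. Assume that the sequence $(\widehat F_t)_{t\ge1}$ of random elements of $L^2(\mu)$ is $\psi$-mixing with $\sum_{k\ge1}k\,\Psi(k)^{1/2}<\infty$, where $$\Psi(k)=\sup_{j\ge1}\sup\Big\{\Big|\frac{\mathbb P(A\cap B)}{\mathbb P(A)\mathbb P(B)}-1\Big| : A\in\sigma(\widehat F_1,\dots,\widehat F_j),\ B\in\sigma(\widehat F_{j+k},\widehat F_{j+k+1},\dots),\ \mathbb P(A)\mathbb P(B)>0\Big\}.$$ Then, for $1\le t\le n$, as $n\to\infty$, $$\widetilde F_t=F_t+\langle\varepsilon_t,\psi_1\rangle\psi_1+O_{\mathbb P}(n^{-1/2})\quad\text{in }L^2(\mu),$$ that is: for every $\epsilon>0$ there are $M$ and $N$ such that $\mathbb P\big(\sqrt n\,\|\widetilde F_t-F_t-\langle\varepsilon_t,\psi_1\rangle\psi_1\|>M\big)\le\epsilon$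 for all $n\ge N$ and all $1\le t\le n$. -/

import Mathlib

open MeasureTheory ProbabilityTheory Filter Topology Set
open scoped ENNReal NNReal

noncomputable section

namespace ConjProc

/-! ### Bounded kernels and integral operators on `L²(μ)` -/

/-- A jointly measurable, bounded kernel on `ℝ × ℝ`. -/
def IsBddKernel (K : ℝ → ℝ → ℝ) : Prop :=
  Measurable (Function.uncurry K) ∧ ∃ c : ℝ, ∀ x y, |K x y| ≤ c

theorem IsBddKernel.integrable_mul {μ : Measure ℝ} [IsFiniteMeasure μ] {K : ℝ → ℝ → ℝ}
    (hK : IsBddKernel K) (x : ℝ) (f : Lp ℝ 2 μ) : Integrable (fun y => K x y * f y) μ := by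
  obtain ⟨hm, c, hc⟩ := hK
  have hf : Integrable (f : ℝ → ℝ) μ := (Lp.memLp f).integrable (by norm_num)
  refine hf.bdd_mul (c := c) ?_ (Eventually.of_forall fun y => by simpa using hc x y)
  exact (hm.comp (measurable_const.prodMk measurable_id)).aestronglyMeasurable

theorem IsBddKernel.memLp {μ : Measure ℝ} [IsFiniteMeasure μ] {K : ℝ → ℝ → ℝ}
    (hK : IsBddKernel K) (f : Lp ℝ 2 μ) : MemLp (fun x => ∫ y, K x y * f y ∂μ) 2 μ := by
  have hint := fun x => hK.integrable_mul x f
  obtain ⟨hm, c, hc⟩ := hK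
  have hf : Integrable (f : ℝ → ℝ) μ := (Lp.memLp f).integrable (by norm_num)
  refine MemLp.of_bound (C := ∫ y, c * ‖f y‖ ∂μ) ?_ (Eventually.of_forall fun x => ?_)
  · refine StronglyMeasurable.aestronglyMeasurable ?_
    refine StronglyMeasurable.integral_prod_right (f := fun x y => K x y * f y) ?_
    exact hm.stronglyMeasurable.mul
      ((Lp.stronglyMeasurable f).comp_measurable measurable_snd)
  · refine norm_integral_le_of_norm_le (hf.norm.const_mul c) (Eventually.of_forall fun y => ?_)
    rw [norm_mul]
    exact mul_le_mul_of_nonneg_right (hc x y) (norm_nonneg _)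

/-- The operator `f ↦ (x ↦ ∫ K(x,y) f(y) μ(dy))` on `L²(μ)`. -/
def integralOperator (μ : Measure ℝ) [IsFiniteMeasure μ] (K : ℝ → ℝ → ℝ)
    (hK : IsBddKernel K) : Lp ℝ 2 μ →ₗ[ℝ] Lp ℝ 2 μ where
  toFun f := (hK.memLp f).toLp _
  map_add' f g := by
    rw [← MemLp.toLp_add]
    refine MemLp.toLp_congr _ _ (Eventually.of_forall fun x => ?_)
    change _ = (∫ y, K x y * f y ∂μ) + ∫ y, K x y * g y ∂μ
    rw [← integral_add (hK.integrable_mul x f) (hK.integrable_mul x g)]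
    refine integral_congr_ae ?_
    filter_upwards [Lp.coeFn_add f g] with y hy
    rw [hy, Pi.add_apply, mul_add]
  map_smul' a f := by
    rw [RingHom.id_apply, ← MemLp.toLp_const_smul]
    refine MemLp.toLp_congr _ _ (Eventually.of_forall fun x => ?_)
    change _ = a • ∫ y, K x y * f y ∂μ
    rw [← integral_smul]
    refine integral_congr_ae ?_
    filter_upwards [Lp.coeFn_smul a f] with y hy
    rw [hy, Pi.smul_apply, smul_eq_mul, smul_eq_mul, mul_left_comm]

/-- From lagged kernels `C₁, C₂, …` the kernel
`R(x,y) = ∑_{k=1}^p ∫ C_k(x,z) C_k(y,z) μ(dz)`. -/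
def sumKernel (μ : Measure ℝ) (p : ℕ) (C : ℕ → ℝ → ℝ → ℝ) (x y : ℝ) : ℝ :=
  ∑ k ∈ Finset.Icc 1 p, ∫ z, C k x z * C k y z ∂μ

theorem isBddKernel_sumKernel (μ : Measure ℝ) [IsFiniteMeasure μ] (p : ℕ)
    {C : ℕ → ℝ → ℝ → ℝ} (hC : ∀ k, IsBddKernel (C k)) : IsBddKernel (sumKernel μ p C) := by
  choose hm c hc using hC
  constructor
  · unfold Function.uncurry sumKernel
    refine Finset.measurable_sum _ fun k _ => StronglyMeasurable.measurable ?_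
    refine StronglyMeasurable.integral_prod_right
      (f := fun (a : ℝ × ℝ) z => C k a.1 z * C k a.2 z) ?_
    refine Measurable.stronglyMeasurable ?_
    exact ((hm k).comp ((measurable_fst.comp measurable_fst).prodMk measurable_snd)).mul
      ((hm k).comp ((measurable_snd.comp measurable_fst).prodMk measurable_snd))
  · refine ⟨∑ k ∈ Finset.Icc 1 p, (c k * c k) * μ.real univ, fun x y => ?_⟩
    refine (Finset.abs_sum_le_sum_abs _ _).trans (Finset.sum_le_sum fun k _ => ?_)
    rw [← Real.norm_eq_abs]
    refine norm_integral_le_of_norm_le_const (μ := μ) (Eventually.of_forall fun z => ?_)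
    rw [norm_mul]
    exact mul_le_mul (hc k x z) (hc k y z) (norm_nonneg _)
      ((abs_nonneg _).trans (hc k x z))

/-- `ψ` is a unit eigenvector of `T` belonging to its largest eigenvalue. -/
def IsLeadingEigenfunction {μ : Measure ℝ} (T : Lp ℝ 2 μ →ₗ[ℝ] Lp ℝ 2 μ)
    (ψ : Lp ℝ 2 μ) : Prop :=
  ‖ψ‖ = 1 ∧ ∃ θ : ℝ, T ψ = θ • ψ ∧ ∀ θ' : ℝ, Module.End.HasEigenvalue T θ' → θ' ≤ θ

/-- Two operators are range-equivalent if the closures of their ranges coincide. -/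
def RangeEquivalent {μ : Measure ℝ} (T S : Lp ℝ 2 μ →ₗ[ℝ] Lp ℝ 2 μ) : Prop :=
  closure (T.range : Set (Lp ℝ 2 μ)) = closure (S.range : Set (Lp ℝ 2 μ))

/-! ### The model -/

section Model

variable {Ω : Type*} [MeasurableSpace Ω]

/-- The `σ`-field `Ξ = σ(ξ₀, ξ₁, …)`. -/
@[reducible] def latentSigma (ξ : ℕ → Ω → ProbabilityMeasure ℝ) : MeasurableSpace Ω :=
  ⨆ t, MeasurableSpace.comap (ξ t) inferInstance

/-- The `t`-th cycle `[t, t+1)`. -/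
def cycle (t : ℕ) : Set ℝ≥0 := Ico (t : ℝ≥0) (t + 1)

/-- `(ξ_t, X_τ)` is a conjugate process: random elements of `M₁(ℝ)` and real random variables
with `P[X_τ ∈ B | Ξ] = ξ_t(B)` almost surely for each Borel set `B` and `τ ∈ [t, t+1)`. -/
structure IsConjugateProcess (P : Measure Ω) (ξ : ℕ → Ω → ProbabilityMeasure ℝ)
    (X : ℝ≥0 → Ω → ℝ) : Prop where
  measurable_latent : ∀ t, Measurable (ξ t)
  measurable_obs : ∀ τ, Measurable (X τ)
  compat : ∀ t : ℕ, ∀ τ ∈ cycle t, ∀ B : Set ℝ, MeasurableSet B →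
    P⟦X τ ⁻¹' B | latentSigma ξ⟧ =ᵐ[P] fun ω => (ξ t ω : Measure ℝ).real B

/-- Strict stationarity of the latent sequence. -/
def IsStationaryLatent (P : Measure Ω) (ξ : ℕ → Ω → ProbabilityMeasure ℝ) : Prop :=
  P.map (fun ω (t : ℕ) => ξ (t + 1) ω) = P.map (fun ω (t : ℕ) => ξ t ω)

/-- The `σ`-field generated by the observable process during cycle `t`. -/
@[reducible] def cycleSigma (X : ℝ≥0 → Ω → ℝ) (t : ℕ) : MeasurableSpace Ω :=
  ⨆ τ ∈ cycle t, MeasurableSpace.comap (X τ) inferInstance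

/-- Conditionally on `Ξ`, the processes `(X_τ : τ ∈ [t, t+1))`, `t = 0, 1, …`, are independent. -/
def CyclicIndependent (P : Measure Ω) (ξ : ℕ → Ω → ProbabilityMeasure ℝ)
    (X : ℝ≥0 → Ω → ℝ) : Prop :=
  ∀ (S : Finset ℕ) (A : ℕ → Set Ω), (∀ t ∈ S, MeasurableSet[cycleSigma X t] (A t)) →
    P⟦⋂ t ∈ S, A t | latentSigma ξ⟧ =ᵐ[P] ∏ t ∈ S, P⟦A t | latentSigma ξ⟧

/-- The barycenter `𝔼ξ₀`, i.e. `B ↦ 𝔼(ξ₀(B))`. -/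
def meanMeasure (P : Measure Ω) (ξ : ℕ → Ω → ProbabilityMeasure ℝ) : Measure ℝ :=
  P.bind fun ω => (ξ 0 ω : Measure ℝ)

/-- `μ` is a diffraction: it is equivalent to Lebesgue measure on some interval containing the
support of `𝔼ξ₀`. -/
def IsDiffraction (P : Measure Ω) (ξ : ℕ → Ω → ProbabilityMeasure ℝ) (μ : Measure ℝ) : Prop :=
  ∃ I : Set ℝ, I.OrdConnected ∧ (meanMeasure P ξ).support ⊆ I ∧
    μ ≪ volume.restrict I ∧ volume.restrict I ≪ μ

/-- `n⁻¹ ∑_{t=1}^n ξ_t → 𝔼ξ₀` in probability, for the Lévy–Prokhorov metric (which metrizes the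
weak topology of `M₁(ℝ)`). -/
def IsErgodicInProbability (P : Measure Ω) (ξ : ℕ → Ω → ProbabilityMeasure ℝ) : Prop :=
  ∀ δ : ℝ≥0∞, 0 < δ → Tendsto (fun n : ℕ =>
    P {ω | δ ≤ levyProkhorovEDist
      ((n : ℝ≥0∞)⁻¹ • ∑ t ∈ Finset.Icc 1 n, (ξ t ω : Measure ℝ)) (meanMeasure P ξ)})
    atTop (𝓝 0)

/-! ### Distribution functions in `L²(μ)` and the population operators -/

theorem memLp_cdf (μ : Measure ℝ) [IsFiniteMeasure μ] (ν : ProbabilityMeasure ℝ) :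
    MemLp (fun x => cdf (ν : Measure ℝ) x) 2 μ :=
  MemLp.of_bound (monotone_cdf _).measurable.aestronglyMeasurable 1
    (Eventually.of_forall fun x => by
      rw [Real.norm_eq_abs, abs_of_nonneg (cdf_nonneg _ x)]; exact cdf_le_one _ x)

/-- `F_t`, where `F_t(x) = ξ_t(-∞, x]`, as an element of `L²(μ)`. -/
def latentCdf (μ : Measure ℝ) [IsFiniteMeasure μ] (ξ : ℕ → Ω → ProbabilityMeasure ℝ)
    (t : ℕ) (ω : Ω) : Lp ℝ 2 μ :=
  (memLp_cdf μ (ξ t ω)).toLp _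

/-- The autocovariance `C_k(x,y) = Cov(F₀(x), F_k(y))`. -/
def autoCov (P : Measure Ω) (ξ : ℕ → Ω → ProbabilityMeasure ℝ) (k : ℕ) (x y : ℝ) : ℝ :=
  cov[fun ω => cdf (ξ 0 ω : Measure ℝ) x, fun ω => cdf (ξ k ω : Measure ℝ) y; P]

theorem measurable_cdf_uncurry {ξ : Ω → ProbabilityMeasure ℝ} (hξ : Measurable ξ) :
    Measurable fun a : ℝ × Ω => cdf (ξ a.2 : Measure ℝ) a.1 := by
  let κ : Kernel (ℝ × Ω) ℝ :=
    ⟨fun a => (ξ a.2 : Measure ℝ), measurable_subtype_coe.comp (hξ.comp measurable_snd)⟩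
  have : IsMarkovKernel κ := ⟨fun a => by change IsProbabilityMeasure (ξ a.2 : Measure ℝ); infer_instance⟩
  have hs : MeasurableSet {b : (ℝ × Ω) × ℝ | b.2 ≤ b.1.1} :=
    measurableSet_le measurable_snd (measurable_fst.comp measurable_fst)
  have h := (Kernel.measurable_kernel_prodMk_left (κ := κ) hs).ennreal_toReal
  convert h using 2 with a
  rw [cdf_eq_real]
  rfl

theorem isBddKernel_autoCov (P : Measure Ω) [IsProbabilityMeasure P]
    {ξ : ℕ → Ω → ProbabilityMeasure ℝ} (hξ : ∀ t, Measurable (ξ t)) (k : ℕ) :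
    IsBddKernel (autoCov P ξ k) := by
  have hG := fun t => measurable_cdf_uncurry (hξ t)
  have hE : ∀ t, Measurable fun x : ℝ => ∫ ω, cdf (ξ t ω : Measure ℝ) x ∂P := fun t =>
    (StronglyMeasurable.integral_prod_right
      (f := fun x ω => cdf (ξ t ω : Measure ℝ) x) (hG t).stronglyMeasurable).measurable
  have hb : ∀ t x ω, |cdf (ξ t ω : Measure ℝ) x - ∫ ω', cdf (ξ t ω' : Measure ℝ) x ∂P| ≤ 2 := by
    intro t x ω
    have h1 : ∀ ω', ‖cdf (ξ t ω' : Measure ℝ) x‖ ≤ 1 := fun ω' => by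
      rw [Real.norm_eq_abs, abs_of_nonneg (cdf_nonneg _ x)]; exact cdf_le_one _ x
    have h2 := norm_integral_le_of_norm_le_const (μ := P) (Eventually.of_forall h1)
    rw [probReal_univ, mul_one] at h2
    exact (abs_sub _ _).trans (by have := h1 ω; simp only [Real.norm_eq_abs] at this h2; linarith)
  constructor
  · unfold Function.uncurry autoCov covariance
    refine StronglyMeasurable.measurable ?_
    refine StronglyMeasurable.integral_prod_right (f := fun (a : ℝ × ℝ) ω =>
      (cdf (ξ 0 ω : Measure ℝ) a.1 - ∫ ω', cdf (ξ 0 ω' : Measure ℝ) a.1 ∂P) *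
      (cdf (ξ k ω : Measure ℝ) a.2 - ∫ ω', cdf (ξ k ω' : Measure ℝ) a.2 ∂P)) ?_
    refine Measurable.stronglyMeasurable ?_
    have f1 : Measurable fun b : (ℝ × ℝ) × Ω => b.1.1 := measurable_fst.comp measurable_fst
    have f2 : Measurable fun b : (ℝ × ℝ) × Ω => b.1.2 := measurable_snd.comp measurable_fst
    exact (((hG 0).comp (f1.prodMk measurable_snd)).sub ((hE 0).comp f1)).mul
      (((hG k).comp (f2.prodMk measurable_snd)).sub ((hE k).comp f2))
  · refine ⟨2 * 2 * P.real univ, fun x y => ?_⟩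
    rw [← Real.norm_eq_abs]
    refine norm_integral_le_of_norm_le_const (μ := P) (Eventually.of_forall fun ω => ?_)
    rw [norm_mul]
    exact mul_le_mul (hb 0 x ω) (hb k y ω) (norm_nonneg _) (by norm_num)

/-- The lag-`k` autocovariance operator `C_k^μ`. -/
def covOperator (P : Measure Ω) [IsProbabilityMeasure P] {ξ : ℕ → Ω → ProbabilityMeasure ℝ}
    (hξ : ∀ t, Measurable (ξ t)) (μ : Measure ℝ) [IsFiniteMeasure μ] (k : ℕ) :
    Lp ℝ 2 μ →ₗ[ℝ] Lp ℝ 2 μ :=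
  integralOperator μ (autoCov P ξ k) (isBddKernel_autoCov P hξ k)

/-- The operator `R^μ`. -/
def ROperator (P : Measure Ω) [IsProbabilityMeasure P] {ξ : ℕ → Ω → ProbabilityMeasure ℝ}
    (hξ : ∀ t, Measurable (ξ t)) (μ : Measure ℝ) [IsFiniteMeasure μ] (p : ℕ) :
    Lp ℝ 2 μ →ₗ[ℝ] Lp ℝ 2 μ :=
  integralOperator μ (sumKernel μ p (autoCov P ξ))
    (isBddKernel_sumKernel μ p fun k => isBddKernel_autoCov P hξ k)

end Model

/-! ### Sampling and estimators -/

section Sampling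

variable {Ω : Type*}

/-- A sampling scheme: in each cycle `t ≥ 1` the process is observed at `q_t ≥ 1` times
`τ_{1,t}, …, τ_{q_t,t} ∈ [t, t+1)`, so that `X_{it} = X_{τ_{it}}`. -/
def IsSamplingScheme (q : ℕ → ℕ) (τ : (t : ℕ) → Fin (q t) → ℝ≥0) : Prop :=
  ∀ t, 1 ≤ t → 0 < q t ∧ ∀ i, τ t i ∈ cycle t

/-- The empirical cdf `F̂_t(x) = q_t⁻¹ #{i : X_{it} ≤ x}`. -/
def empCdfFun (X : ℝ≥0 → Ω → ℝ) (q : ℕ → ℕ) (τ : (t : ℕ) → Fin (q t) → ℝ≥0)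
    (t : ℕ) (ω : Ω) (x : ℝ) : ℝ :=
  (q t : ℝ)⁻¹ * ∑ i : Fin (q t), (Iic x).indicator (fun _ => (1 : ℝ)) (X (τ t i) ω)

/-- The estimated mean function `n⁻¹ ∑_{t=1}^n F̂_t`. -/
def empMeanFun (X : ℝ≥0 → Ω → ℝ) (q : ℕ → ℕ) (τ : (t : ℕ) → Fin (q t) → ℝ≥0)
    (n : ℕ) (ω : Ω) (x : ℝ) : ℝ :=
  (n : ℝ)⁻¹ * ∑ t ∈ Finset.Icc 1 n, empCdfFun X q τ t ω x

/-- The estimated autocovariance `Ĉ_k(x,y)`, based on cycles `1, …, n` (for `n > p`). -/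
def empAutoCov (X : ℝ≥0 → Ω → ℝ) (q : ℕ → ℕ) (τ : (t : ℕ) → Fin (q t) → ℝ≥0)
    (p n : ℕ) (ω : Ω) (k : ℕ) (x y : ℝ) : ℝ :=
  ((n - p : ℕ) : ℝ)⁻¹ * ∑ t ∈ Finset.Icc 1 (n - p),
    (empCdfFun X q τ t ω x - empMeanFun X q τ n ω x) *
      (empCdfFun X q τ (t + k) ω y - empMeanFun X q τ n ω y)

theorem measurable_empCdfFun (X : ℝ≥0 → Ω → ℝ) (q : ℕ → ℕ) (τ : (t : ℕ) → Fin (q t) → ℝ≥0)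
    (t : ℕ) (ω : Ω) : Measurable (empCdfFun X q τ t ω) := by
  unfold empCdfFun
  refine Measurable.const_mul (Finset.measurable_sum _ fun i _ => ?_) _
  have h : (fun x : ℝ => (Iic x).indicator (fun _ => (1 : ℝ)) (X (τ t i) ω)) =
      (Ici (X (τ t i) ω)).indicator fun _ => (1 : ℝ) := by
    funext x
    simp [indicator]
  rw [h]
  exact measurable_const.indicator measurableSet_Ici

theorem empCdfFun_nonneg (X : ℝ≥0 → Ω → ℝ) (q : ℕ → ℕ) (τ : (t : ℕ) → Fin (q t) → ℝ≥0)
    (t : ℕ) (ω : Ω) (x : ℝ) : 0 ≤ empCdfFun X q τ t ω x :=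
  mul_nonneg (by positivity) (Finset.sum_nonneg fun i _ => indicator_nonneg (by simp) _)

theorem empCdfFun_le_one (X : ℝ≥0 → Ω → ℝ) (q : ℕ → ℕ) (τ : (t : ℕ) → Fin (q t) → ℝ≥0)
    (t : ℕ) (ω : Ω) (x : ℝ) : empCdfFun X q τ t ω x ≤ 1 := by
  have h : ∑ i : Fin (q t), (Iic x).indicator (fun _ => (1 : ℝ)) (X (τ t i) ω) ≤ q t := by
    refine (Finset.sum_le_card_nsmul _ _ 1 fun i _ => ?_).trans (by simp)
    exact indicator_le_self' (by simp) _
  unfold empCdfFun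
  exact inv_mul_le_one_of_le₀ h (by positivity)

theorem measurable_empMeanFun (X : ℝ≥0 → Ω → ℝ) (q : ℕ → ℕ) (τ : (t : ℕ) → Fin (q t) → ℝ≥0)
    (n : ℕ) (ω : Ω) : Measurable (empMeanFun X q τ n ω) :=
  Measurable.const_mul (Finset.measurable_sum _ fun t _ => measurable_empCdfFun X q τ t ω) _

theorem empMeanFun_nonneg (X : ℝ≥0 → Ω → ℝ) (q : ℕ → ℕ) (τ : (t : ℕ) → Fin (q t) → ℝ≥0)
    (n : ℕ) (ω : Ω) (x : ℝ) : 0 ≤ empMeanFun X q τ n ω x :=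
  mul_nonneg (by positivity) (Finset.sum_nonneg fun t _ => empCdfFun_nonneg X q τ t ω x)

theorem empMeanFun_le_one (X : ℝ≥0 → Ω → ℝ) (q : ℕ → ℕ) (τ : (t : ℕ) → Fin (q t) → ℝ≥0)
    (n : ℕ) (ω : Ω) (x : ℝ) : empMeanFun X q τ n ω x ≤ 1 := by
  have h : ∑ t ∈ Finset.Icc 1 n, empCdfFun X q τ t ω x ≤ n :=
    (Finset.sum_le_card_nsmul _ _ 1 fun t _ => empCdfFun_le_one X q τ t ω x).trans (by simp)
  unfold empMeanFun
  exact inv_mul_le_one_of_le₀ h (by positivity)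

theorem isBddKernel_empAutoCov (X : ℝ≥0 → Ω → ℝ) (q : ℕ → ℕ)
    (τ : (t : ℕ) → Fin (q t) → ℝ≥0) (p n : ℕ) (ω : Ω) (k : ℕ) :
    IsBddKernel (empAutoCov X q τ p n ω k) := by
  constructor
  · unfold Function.uncurry empAutoCov
    refine Measurable.const_mul (Finset.measurable_sum _ fun t _ => ?_) _
    exact (((measurable_empCdfFun X q τ t ω).comp measurable_fst).sub
        ((measurable_empMeanFun X q τ n ω).comp measurable_fst)).mul
      (((measurable_empCdfFun X q τ (t + k) ω).comp measurable_snd).sub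
        ((measurable_empMeanFun X q τ n ω).comp measurable_snd))
  · refine ⟨((n - p : ℕ) : ℝ)⁻¹ * ∑ t ∈ Finset.Icc 1 (n - p), 1 * 1, fun x y => ?_⟩
    have hb : ∀ t z, |empCdfFun X q τ t ω z - empMeanFun X q τ n ω z| ≤ 1 := fun t z => by
      have h1 := empCdfFun_nonneg X q τ t ω z
      have h2 := empCdfFun_le_one X q τ t ω z
      have h3 := empMeanFun_nonneg X q τ n ω z
      have h4 := empMeanFun_le_one X q τ n ω z
      rw [abs_le]; constructor <;> linarith
    unfold empAutoCov
    rw [abs_mul, abs_of_nonneg (by positivity : (0 : ℝ) ≤ ((n - p : ℕ) : ℝ)⁻¹)]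
    refine mul_le_mul_of_nonneg_left ?_ (by positivity)
    refine (Finset.abs_sum_le_sum_abs _ _).trans (Finset.sum_le_sum fun t _ => ?_)
    rw [abs_mul]
    exact mul_le_mul (hb t x) (hb _ y) (abs_nonneg _) zero_le_one

/-- The estimated operator `R̂^μ`. -/
def RhatOperator (μ : Measure ℝ) [IsFiniteMeasure μ] (X : ℝ≥0 → Ω → ℝ) (q : ℕ → ℕ)
    (τ : (t : ℕ) → Fin (q t) → ℝ≥0) (p n : ℕ) (ω : Ω) : Lp ℝ 2 μ →ₗ[ℝ] Lp ℝ 2 μ :=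
  integralOperator μ (sumKernel μ p (empAutoCov X q τ p n ω))
    (isBddKernel_sumKernel μ p fun k => isBddKernel_empAutoCov X q τ p n ω k)

theorem memLp_empCdfFun (μ : Measure ℝ) [IsFiniteMeasure μ] (X : ℝ≥0 → Ω → ℝ) (q : ℕ → ℕ)
    (τ : (t : ℕ) → Fin (q t) → ℝ≥0) (t : ℕ) (ω : Ω) : MemLp (empCdfFun X q τ t ω) 2 μ :=
  MemLp.of_bound (measurable_empCdfFun X q τ t ω).aestronglyMeasurable 1
    (Eventually.of_forall fun x => by
      rw [Real.norm_eq_abs, abs_of_nonneg (empCdfFun_nonneg X q τ t ω x)]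
      exact empCdfFun_le_one X q τ t ω x)

theorem memLp_empMeanFun (μ : Measure ℝ) [IsFiniteMeasure μ] (X : ℝ≥0 → Ω → ℝ) (q : ℕ → ℕ)
    (τ : (t : ℕ) → Fin (q t) → ℝ≥0) (n : ℕ) (ω : Ω) : MemLp (empMeanFun X q τ n ω) 2 μ :=
  MemLp.of_bound (measurable_empMeanFun X q τ n ω).aestronglyMeasurable 1
    (Eventually.of_forall fun x => by
      rw [Real.norm_eq_abs, abs_of_nonneg (empMeanFun_nonneg X q τ n ω x)]
      exact empMeanFun_le_one X q τ n ω x)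

/-- `F̂_t` as a random element of `L²(μ)`. -/
def empCdf (μ : Measure ℝ) [IsFiniteMeasure μ] (X : ℝ≥0 → Ω → ℝ) (q : ℕ → ℕ)
    (τ : (t : ℕ) → Fin (q t) → ℝ≥0) (t : ℕ) (ω : Ω) : Lp ℝ 2 μ :=
  (memLp_empCdfFun μ X q τ t ω).toLp _

/-- The estimated mean function as a random element of `L²(μ)`. -/
def empMean (μ : Measure ℝ) [IsFiniteMeasure μ] (X : ℝ≥0 → Ω → ℝ) (q : ℕ → ℕ)
    (τ : (t : ℕ) → Fin (q t) → ℝ≥0) (n : ℕ) (ω : Ω) : Lp ℝ 2 μ :=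
  (memLp_empMeanFun μ X q τ n ω).toLp _

/-- `ε_t = F̂_t - F_t`. -/
def noise (μ : Measure ℝ) [IsFiniteMeasure μ] (ξ : ℕ → Ω → ProbabilityMeasure ℝ)
    (X : ℝ≥0 → Ω → ℝ) (q : ℕ → ℕ) (τ : (t : ℕ) → Fin (q t) → ℝ≥0) (t : ℕ) (ω : Ω) :
    Lp ℝ 2 μ :=
  empCdf μ X q τ t ω - latentCdf μ ξ t ω

/-- `Ŵ_{t1} = ⟨F̂_t - 𝔼̂F₀, ψ̂₁⟩`, where `ψ` stands for the value of `ψ̂₁`. -/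
def What (μ : Measure ℝ) [IsFiniteMeasure μ] (X : ℝ≥0 → Ω → ℝ) (q : ℕ → ℕ)
    (τ : (t : ℕ) → Fin (q t) → ℝ≥0) (n : ℕ) (ψ : Lp ℝ 2 μ) (t : ℕ) (ω : Ω) : ℝ :=
  inner ℝ (empCdf μ X q τ t ω - empMean μ X q τ n ω) ψ

/-- The dimension-reduced estimator `F̃_t = 𝔼̂F₀ + Ŵ_{t1} ψ̂₁` (case `d̂ = 1`). -/
def Ftilde (μ : Measure ℝ) [IsFiniteMeasure μ] (X : ℝ≥0 → Ω → ℝ) (q : ℕ → ℕ)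
    (τ : (t : ℕ) → Fin (q t) → ℝ≥0) (n : ℕ) (ψ : Lp ℝ 2 μ) (t : ℕ) (ω : Ω) : Lp ℝ 2 μ :=
  empMean μ X q τ n ω + What μ X q τ n ψ t ω • ψ

end Sampling

/-! ### ψ-mixing -/

section Mixing

variable {Ω : Type*}

/-- The `ψ`-mixing coefficients of a sequence of `σ`-fields `m₁, m₂, …`:
`Ψ(k) = sup_j sup |P(A ∩ B) / (P(A) P(B)) - 1|` over `A ∈ σ(m₁, …, m_j)` and
`B ∈ σ(m_{j+k}, m_{j+k+1}, …)` with `P(A) P(B) > 0`. -/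
def psiCoeff [MeasurableSpace Ω] (P : Measure Ω) (m : ℕ → MeasurableSpace Ω) (k : ℕ) : ℝ≥0∞ :=
  ⨆ (j : ℕ) (_ : 1 ≤ j) (A : Set Ω) (B : Set Ω)
    (_ : MeasurableSet[⨆ t ∈ Icc 1 j, m t] A) (_ : MeasurableSet[⨆ t ∈ Ici (j + k), m t] B)
    (_ : 0 < P.real A * P.real B),
    ENNReal.ofReal |P.real (A ∩ B) / (P.real A * P.real B) - 1|

/-- The `σ`-field generated by the `L²(μ)`-valued random element `F̂_t`. -/
@[reducible] def empCdfSigma (μ : Measure ℝ) [IsFiniteMeasure μ] (X : ℝ≥0 → Ω → ℝ) (q : ℕ → ℕ)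
    (τ : (t : ℕ) → Fin (q t) → ℝ≥0) (t : ℕ) : MeasurableSpace Ω :=
  MeasurableSpace.comap (empCdf μ X q τ t) (borel (Lp ℝ 2 μ))

/-- A sequence of `σ`-fields is `ψ`-mixing if its `ψ`-mixing coefficients tend to `0`. -/
def IsPsiMixing [MeasurableSpace Ω] (P : Measure Ω) (m : ℕ → MeasurableSpace Ω) : Prop :=
  Tendsto (psiCoeff P m) atTop (𝓝 0)

end Mixing

end ConjProc

end

open ConjProc

/-! Write `m` for the mean function 𝔼F₀ and `m̂` for its estimate. Since `C₀^μ` has rank one and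
`R^μ` is symmetric, positive and has the same closed range, `R^μ` is `θ ⟨·,ψ⟩ ψ` with `θ > 0`, and
`C₀^μ` also has range in the span of `ψ` (`eq_smul_of_rank_one`). The variance of `⟨F_t - m, f⟩` is
`⟨C₀^μ f, f⟩`, which vanishes for `f ⊥ ψ`; hence `F_t - m` is almost surely a multiple of `ψ`
(`ae_latentCdf_sub_eq`), and the target `F_t + ⟨ε_t,ψ⟩ψ` equals `m + ⟨F̂_t - m,ψ⟩ψ`.

With `φ` for the estimated eigenfunction, the error of the estimator is therefore `(m̂ - m) - ⟨m̂ -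
m,φ⟩φ` plus the difference of the projections onto `φ` and `ψ`, applied to `F̂_t - m`. The last
vector has norm at most `√μ(ℝ)`, which makes the bound uniform in `t`. The projections differ by a
multiple of `‖R̂^μ - R^μ‖ / θ`, by an eigenvector perturbation argument in which only the
projections matter, so the sign of `φ` is irrelevant. The operator difference is controlled by the
Hilbert–Schmidt norms of `Ĉ_k - C_k` (`norm_sumKernel_sub_le`).

It remains to see that `m̂ - m` and the `Ĉ_k - C_k` are `O(n^{-1/2})` in mean square. Given `Ξ`,
`F̂_t` is unbiased for `F_t`, and different cycles are conditionally independent, so for `k ≥ 1`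
products of centred empirical cdfs at lag `k` have expectation `C_k`. Mixing makes the covariances
of these bounded variables summable, so each pointwise mean square is `O(1/n)`; Fubini carries this
to `L²` (`integral_estError_le`), and Markov's inequality ends the proof. -/

namespace ConjProc

/-! ### Integral operators: Hilbert–Schmidt bounds, adjoints and the factorisation of `R`. -/

section Kernel

variable {μ : Measure ℝ}

theorem norm_sq_eq_integral (f : Lp ℝ 2 μ) : ‖f‖ ^ 2 = ∫ x, f x ^ 2 ∂μ := by
  rw [← real_inner_self_eq_norm_sq, L2.inner_def]
  simp [sq]

theorem inner_eq_integral_mul (f g : Lp ℝ 2 μ) : inner ℝ f g = ∫ x, f x * g x ∂μ := by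
  rw [L2.inner_def]
  simp [mul_comm]

theorem norm_toLp_sq {f : ℝ → ℝ} (hf : MemLp f 2 μ) :
    ‖hf.toLp f‖ ^ 2 = ∫ x, f x ^ 2 ∂μ := by
  rw [norm_sq_eq_integral]
  refine integral_congr_ae ?_
  filter_upwards [hf.coeFn_toLp] with x hx
  rw [hx]

theorem inner_toLp {f : ℝ → ℝ} (hf : MemLp f 2 μ) (g : Lp ℝ 2 μ) :
    inner ℝ (hf.toLp f) g = ∫ x, f x * g x ∂μ := by
  rw [inner_eq_integral_mul]
  refine integral_congr_ae ?_
  filter_upwards [hf.coeFn_toLp] with x hx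
  rw [hx]

theorem integrable_kernel_mul_mul {K : ℝ → ℝ → ℝ} (hK : IsBddKernel K) {f g : ℝ → ℝ}
    (hf : Integrable f μ) (hg : Integrable g μ) :
    Integrable (Function.uncurry fun x y => K x y * g y * f x) (μ.prod μ) := by
  obtain ⟨hm, c, hc⟩ := hK
  have h := (hf.mul_prod hg).bdd_mul (c := c) hm.aestronglyMeasurable
    (Eventually.of_forall fun z => hc z.1 z.2)
  refine h.congr (Eventually.of_forall fun z => ?_)
  simp only [Function.uncurry]
  ring

variable [IsFiniteMeasure μ]

theorem IsBddKernel.swap {K : ℝ → ℝ → ℝ} (hK : IsBddKernel K) :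
    IsBddKernel fun x y => K y x :=
  ⟨hK.1.comp measurable_swap, hK.2.imp fun _ h x y => h y x⟩

theorem IsBddKernel.sub {K L : ℝ → ℝ → ℝ} (hK : IsBddKernel K) (hL : IsBddKernel L) :
    IsBddKernel fun x y => K x y - L x y := by
  obtain ⟨hm, c, hc⟩ := hK
  obtain ⟨hm', c', hc'⟩ := hL
  exact ⟨hm.sub hm', c + c', fun x y =>
    (abs_sub _ _).trans (add_le_add (hc x y) (hc' x y))⟩

theorem IsBddKernel.measurable_apply {K : ℝ → ℝ → ℝ} (hK : IsBddKernel K) (x : ℝ) :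
    Measurable (K x) :=
  hK.1.comp (measurable_const.prodMk measurable_id)

theorem IsBddKernel.memLp_apply {K : ℝ → ℝ → ℝ} (hK : IsBddKernel K) (x : ℝ) :
    MemLp (K x) 2 μ := by
  obtain ⟨c, hc⟩ := hK.2
  exact MemLp.of_bound (hK.measurable_apply x).aestronglyMeasurable c
    (Eventually.of_forall fun y => hc x y)

theorem coeFn_integralOperator {K : ℝ → ℝ → ℝ} (hK : IsBddKernel K) (f : Lp ℝ 2 μ) :
    integralOperator μ K hK f =ᵐ[μ] fun x => ∫ y, K x y * f y ∂μ :=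
  MemLp.coeFn_toLp (hK.memLp f)

theorem IsBddKernel.integrable_integral_sq {K : ℝ → ℝ → ℝ} (hK : IsBddKernel K) :
    Integrable (fun x => ∫ y, K x y ^ 2 ∂μ) μ := by
  obtain ⟨hm, c, hc⟩ := hK
  refine Integrable.of_bound (C := c ^ 2 * μ.real univ) ?_ (Eventually.of_forall fun x => ?_)
  · refine StronglyMeasurable.aestronglyMeasurable ?_
    exact StronglyMeasurable.integral_prod_right (f := fun x y => K x y ^ 2)
      (hm.pow_const 2).stronglyMeasurable
  · refine norm_integral_le_of_norm_le_const (Eventually.of_forall fun y => ?_)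
    rw [norm_pow, Real.norm_eq_abs]
    exact pow_le_pow_left₀ (abs_nonneg _) (hc x y) 2

/-- The Hilbert–Schmidt norm of a kernel. -/
noncomputable def hsNorm (μ : Measure ℝ) (K : ℝ → ℝ → ℝ) : ℝ :=
  √(∫ x, ∫ y, K x y ^ 2 ∂μ ∂μ)

/-- Cauchy–Schwarz in `y` for each fixed `x`, then integration over `x`. -/
theorem norm_integralOperator_le {K : ℝ → ℝ → ℝ} (hK : IsBddKernel K) (f : Lp ℝ 2 μ) :
    ‖integralOperator μ K hK f‖ ≤ hsNorm μ K * ‖f‖ := by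
  refine le_of_sq_le_sq ?_ (by unfold hsNorm; positivity)
  have h0 : 0 ≤ ∫ x, ∫ y, K x y ^ 2 ∂μ ∂μ :=
    integral_nonneg fun x => integral_nonneg fun y => sq_nonneg _
  rw [mul_pow, hsNorm, Real.sq_sqrt h0, integralOperator, ← integral_mul_const]
  change ‖(hK.memLp f).toLp _‖ ^ 2 ≤ _
  rw [norm_toLp_sq]
  refine integral_mono (hK.memLp f).integrable_sq (hK.integrable_integral_sq.mul_const _) fun x => ?_
  change (∫ y, K x y * f y ∂μ) ^ 2 ≤ (∫ y, K x y ^ 2 ∂μ) * ‖f‖ ^ 2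
  rw [← inner_toLp (hK.memLp_apply x) f, ← norm_toLp_sq (hK.memLp_apply x), ← mul_pow]
  exact sq_le_sq.2 ((abs_real_inner_le_norm _ _).trans (le_abs_self _))

theorem hsNorm_le_of_bound {K : ℝ → ℝ → ℝ} {c : ℝ} (hc : ∀ x y, |K x y| ≤ c) :
    hsNorm μ K ≤ c * μ.real univ := by
  have h0 : 0 ≤ c := (abs_nonneg _).trans (hc 0 0)
  refine Real.sqrt_le_iff.2 ⟨by positivity, ?_⟩
  have h1 : ∀ x, ‖∫ y, K x y ^ 2 ∂μ‖ ≤ c ^ 2 * μ.real univ := fun x =>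
    norm_integral_le_of_norm_le_const (Eventually.of_forall fun y => by
      rw [norm_pow, Real.norm_eq_abs]
      exact pow_le_pow_left₀ (abs_nonneg _) (hc x y) 2)
  refine (le_abs_self _).trans
    ((norm_integral_le_of_norm_le_const (Eventually.of_forall h1)).trans (le_of_eq ?_))
  ring

theorem hsNorm_swap {K : ℝ → ℝ → ℝ} (hK : IsBddKernel K) :
    hsNorm μ (fun x y => K y x) = hsNorm μ K := by
  obtain ⟨hm, c, hc⟩ := hK
  unfold hsNorm
  congr 1
  refine integral_integral_swap (f := fun x y => K y x ^ 2) ?_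
  refine Integrable.of_bound (C := c ^ 2) ?_ (Eventually.of_forall fun x => ?_)
  · exact ((hm.comp measurable_swap).pow_const 2).aestronglyMeasurable
  · simp only [Function.uncurry, norm_pow, Real.norm_eq_abs]
    exact pow_le_pow_left₀ (abs_nonneg _) (hc _ _) 2

theorem Lp.integrable_two (f : Lp ℝ 2 μ) : Integrable (f : ℝ → ℝ) μ :=
  (Lp.memLp f).integrable (by norm_num)

/-- By Fubini, the adjoint is given by the transposed kernel. -/
theorem inner_integralOperator {K : ℝ → ℝ → ℝ} (hK : IsBddKernel K) (f g : Lp ℝ 2 μ) :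
    inner ℝ (integralOperator μ K hK f) g = inner ℝ f (integralOperator μ _ hK.swap g) := by
  rw [real_inner_comm _ f]
  change inner ℝ ((hK.memLp f).toLp _) g = inner ℝ ((hK.swap.memLp g).toLp _) f
  rw [inner_toLp, inner_toLp]
  simp_rw [← integral_mul_const]
  rw [integral_integral_swap
    (integrable_kernel_mul_mul hK (Lp.integrable_two g) (Lp.integrable_two f))]
  refine integral_congr_ae (Eventually.of_forall fun y => integral_congr_ae
    (Eventually.of_forall fun x => ?_))
  change K x y * f y * g x = K x y * g x * f y
  ring

theorem integralOperator_sub {K L : ℝ → ℝ → ℝ} (hK : IsBddKernel K) (hL : IsBddKernel L)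
    (f : Lp ℝ 2 μ) : integralOperator μ K hK f - integralOperator μ L hL f =
      integralOperator μ _ (hK.sub hL) f := by
  refine Lp.ext ?_
  filter_upwards [Lp.coeFn_sub (integralOperator μ K hK f) (integralOperator μ L hL f),
    coeFn_integralOperator hK f, coeFn_integralOperator hL f,
    coeFn_integralOperator (hK.sub hL) f] with x h1 h2 h3 h4
  rw [h1, Pi.sub_apply, h2, h3, h4, ← integral_sub (hK.integrable_mul x f)
    (hL.integrable_mul x f)]
  simp_rw [sub_mul]

/-- Fubini turns the kernel of `R` into the operator identity `R = ∑ C_k C_k^*`. Symmetry,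
positivity and the perturbation bound for `R` all come from this form. -/
theorem integralOperator_sumKernel (p : ℕ) {C : ℕ → ℝ → ℝ → ℝ} (hC : ∀ k, IsBddKernel (C k))
    (f : Lp ℝ 2 μ) : integralOperator μ (sumKernel μ p C) (isBddKernel_sumKernel μ p hC) f =
      ∑ k ∈ Finset.Icc 1 p,
        integralOperator μ (C k) (hC k) (integralOperator μ _ (hC k).swap f) := by
  refine Lp.ext ?_
  have h1 : ∀ k, ∀ᵐ x ∂μ, integralOperator μ (C k) (hC k) (integralOperator μ _ (hC k).swap f) x
      = ∫ z, C k x z * (integralOperator μ _ (hC k).swap f) z ∂μ := fun k =>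
    coeFn_integralOperator _ _
  filter_upwards [coeFn_integralOperator (isBddKernel_sumKernel μ p hC) f, ae_all_iff.2 h1,
    Lp.coeFn_finsetSum (Finset.Icc 1 p) fun k =>
      integralOperator μ (C k) (hC k) (integralOperator μ _ (hC k).swap f)] with x hx1 hx2 hx3
  rw [hx1, hx3, Finset.sum_apply]
  simp_rw [hx2, sumKernel, Finset.sum_mul]
  have hint : ∀ k, Integrable (Function.uncurry fun y z => C k y z * C k x z * f y)
      (μ.prod μ) := fun k => integrable_kernel_mul_mul (hC k) (Lp.integrable_two f)
        (((hC k).memLp_apply x).integrable (by norm_num))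
  have e : ∀ k y, (∫ z, C k x z * C k y z ∂μ) * f y = ∫ z, C k y z * C k x z * f y ∂μ :=
    fun k y => by
      rw [← integral_mul_const]
      exact integral_congr_ae (Eventually.of_forall fun z => by simp only; ring)
  simp_rw [e]
  have hint' : ∀ k, Integrable (fun y => ∫ z, C k y z * C k x z * f y ∂μ) μ := fun k =>
    (hint k).integral_prod_left
  rw [integral_finsetSum _ fun k _ => hint' k]
  refine Finset.sum_congr rfl fun k _ => ?_
  rw [integral_integral_swap (hint k)]
  refine integral_congr_ae ?_
  filter_upwards [coeFn_integralOperator (hC k).swap f] with z hz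
  rw [hz, ← integral_const_mul]
  exact integral_congr_ae (Eventually.of_forall fun y => by simp only; ring)

theorem sumKernel_symmetric (p : ℕ) {C : ℕ → ℝ → ℝ → ℝ} (hC : ∀ k, IsBddKernel (C k)) :
    (integralOperator μ (sumKernel μ p C) (isBddKernel_sumKernel μ p hC)).IsSymmetric := by
  intro f g
  rw [integralOperator_sumKernel p hC, integralOperator_sumKernel p hC, sum_inner, inner_sum]
  refine Finset.sum_congr rfl fun k _ => ?_
  rw [inner_integralOperator, ← inner_integralOperator (hC k).swap]

theorem inner_sumKernel_self_nonneg (p : ℕ) {C : ℕ → ℝ → ℝ → ℝ} (hC : ∀ k, IsBddKernel (C k))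
    (f : Lp ℝ 2 μ) :
    0 ≤ inner ℝ (integralOperator μ (sumKernel μ p C) (isBddKernel_sumKernel μ p hC) f) f := by
  rw [integralOperator_sumKernel p hC, sum_inner]
  refine Finset.sum_nonneg fun k _ => ?_
  rw [inner_integralOperator]
  exact real_inner_self_nonneg

/-- Telescope `C C^* - D D^* = (C - D) C^* + D (C - D)^*`; transposition preserves the
Hilbert–Schmidt norm, and kernels bounded by 1 have norm at most `μ(ℝ)`. -/
theorem norm_sumKernel_sub_le (p : ℕ) {C D : ℕ → ℝ → ℝ → ℝ} (hC : ∀ k, IsBddKernel (C k))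
    (hD : ∀ k, IsBddKernel (D k)) (hC1 : ∀ k x y, |C k x y| ≤ 1) (hD1 : ∀ k x y, |D k x y| ≤ 1)
    (f : Lp ℝ 2 μ) :
    ‖integralOperator μ (sumKernel μ p C) (isBddKernel_sumKernel μ p hC) f -
      integralOperator μ (sumKernel μ p D) (isBddKernel_sumKernel μ p hD) f‖ ≤
      (2 * μ.real univ * ∑ k ∈ Finset.Icc 1 p, hsNorm μ fun x y => C k x y - D k x y) * ‖f‖ := by
  rw [integralOperator_sumKernel p hC, integralOperator_sumKernel p hD, ← Finset.sum_sub_distrib,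
    Finset.mul_sum, Finset.sum_mul]
  refine norm_sum_le_of_le _ fun k _ => ?_
  set h := hsNorm μ fun x y => C k x y - D k x y with hh
  have h0 : 0 ≤ h := Real.sqrt_nonneg _
  have e : integralOperator μ (C k) (hC k) (integralOperator μ _ (hC k).swap f) -
      integralOperator μ (D k) (hD k) (integralOperator μ _ (hD k).swap f) =
      integralOperator μ _ ((hC k).sub (hD k)) (integralOperator μ _ (hC k).swap f) +
      integralOperator μ (D k) (hD k) (integralOperator μ _ ((hC k).swap.sub (hD k).swap) f) := by
    rw [← integralOperator_sub (hC k) (hD k), ← integralOperator_sub (hC k).swap (hD k).swap,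
      map_sub]
    abel
  rw [e]
  have n1 := norm_integralOperator_le (μ := μ) (hC k).swap f
  have n2 := norm_integralOperator_le (μ := μ) ((hC k).swap.sub (hD k).swap) f
  have n3 := norm_integralOperator_le ((hC k).sub (hD k))
    (integralOperator μ _ (hC k).swap f)
  have n4 := norm_integralOperator_le (hD k)
    (integralOperator μ _ ((hC k).swap.sub (hD k).swap) f)
  have b1 := hsNorm_le_of_bound (μ := μ) (K := fun x y => C k y x) fun x y => hC1 k y x
  have b2 := hsNorm_le_of_bound (μ := μ) (hD1 k)
  have e2 : hsNorm μ (fun x y => C k y x - D k y x) = h := hsNorm_swap ((hC k).sub (hD k))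
  rw [e2] at n2
  rw [one_mul] at b1 b2
  have hμ : 0 ≤ μ.real univ := measureReal_nonneg
  calc _ ≤ h * (μ.real univ * ‖f‖) + μ.real univ * (h * ‖f‖) := by
        refine norm_add_le_of_le (n3.trans ?_) (n4.trans ?_)
        · refine mul_le_mul_of_nonneg_left (n1.trans ?_) h0
          exact mul_le_mul_of_nonneg_right b1 (norm_nonneg _)
        · exact mul_le_mul b2 n2 (norm_nonneg _) hμ
    _ = _ := by ring

end Kernel

/-! ### Leading eigenvectors: perturbation and the rank-one case. -/

section Hilbert

variable {E : Type*} [NormedAddCommGroup E] [InnerProductSpace ℝ E]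

/-- The supremum of the Rayleigh quotients is an eigenvalue, and it dominates the quotient at `x`.
-/
theorem exists_eigenvalue_ge_of_finiteDimensional [FiniteDimensional ℝ E] {T : E →ₗ[ℝ] E}
    (hT : T.IsSymmetric) {x : E} (hx : ‖x‖ = 1) :
    ∃ c : ℝ, Module.End.HasEigenvalue T c ∧ inner ℝ (T x) x ≤ c := by
  have hx0 : x ≠ 0 := by rintro rfl; simp at hx
  have : Nontrivial E := ⟨x, 0, hx0⟩
  refine ⟨_, hT.hasEigenvalue_iSup_of_finiteDimensional, ?_⟩
  have hb : BddAbove (range fun y : {y : E // y ≠ 0} =>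
      RCLike.re (inner ℝ (T y) (y : E)) / ‖(y : E)‖ ^ 2) := by
    refine ⟨‖LinearMap.toContinuousLinearMap T‖, ?_⟩
    rintro _ ⟨y, rfl⟩
    have hy : 0 < ‖(y : E)‖ := norm_pos_iff.2 y.2
    refine (div_le_iff₀ (by positivity)).2 ?_
    refine (real_inner_le_norm _ _).trans ?_
    have h := (LinearMap.toContinuousLinearMap T).le_opNorm y
    rw [sq, ← mul_assoc]
    exact mul_le_mul_of_nonneg_right h hy.le
  have h := le_ciSup hb ⟨x, hx0⟩
  simpa [hx] using h

/-- Adjoining `x` to `V` gives a finite-dimensional invariant subspace containing `x`, so finite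
rank takes the place of compactness. -/
theorem exists_eigenvalue_ge {T : E →ₗ[ℝ] E} (hT : T.IsSymmetric) {V : Submodule ℝ E}
    [FiniteDimensional ℝ V] (hV : ∀ f, T f ∈ V) {x : E} (hx : ‖x‖ = 1) :
    ∃ c : ℝ, Module.End.HasEigenvalue T c ∧ inner ℝ (T x) x ≤ c := by
  let W : Submodule ℝ E := V ⊔ Submodule.span ℝ {x}
  have hW : ∀ f ∈ W, T f ∈ W := fun f _ => le_sup_left (a := V) (hV f)
  have hxW : x ∈ W := le_sup_right (a := V) (Submodule.mem_span_singleton_self x)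
  obtain ⟨c, hc, hle⟩ := exists_eigenvalue_ge_of_finiteDimensional (hT.restrict_invariant hW)
    (x := (⟨x, hxW⟩ : W)) hx
  refine ⟨c, ?_, hle⟩
  obtain ⟨v, hv⟩ := hc.exists_hasEigenvector
  refine Module.End.hasEigenvalue_of_hasEigenvector (x := (v : E))
    ⟨Module.End.mem_eigenspace_iff.2 ?_, fun h => hv.2 (Subtype.ext h)⟩
  exact congrArg Subtype.val hv.apply_eq_smul

/-- Let `b` be the component of `φ` orthogonal to `ψ`. As `T φ` is a multiple of `ψ`, testing `S φ =
θ φ` against `b` gives `θ ‖b‖² = ⟨b, (S - T) φ⟩ ≤ δ ‖b‖`. If `δ ≤ c / 2`, then `θ ≥ c - δ ≥ c / 2`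
by the Rayleigh quotient of `S` at `ψ`; otherwise the bound exceeds 1 and `‖b‖ ≤ 1` suffices. -/
theorem norm_le_of_eigenvector_of_perturbation {T S : E →ₗ[ℝ] E} {V : Submodule ℝ E}
    [FiniteDimensional ℝ V] (hS : S.IsSymmetric) (hV : ∀ f, S f ∈ V) {c : ℝ} (hc : 0 < c)
    {ψ : E} (hψ : ‖ψ‖ = 1) (hT : ∀ f, T f = (c * inner ℝ f ψ) • ψ) {δ : ℝ}
    (hδ : ∀ f, ‖S f - T f‖ ≤ δ * ‖f‖) {φ : E} (hφ : ‖φ‖ = 1) {θ : ℝ} (hθ : S φ = θ • φ)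
    (hmax : ∀ θ', Module.End.HasEigenvalue S θ' → θ' ≤ θ) :
    ‖φ - inner ℝ φ ψ • ψ‖ ≤ 2 * δ / c := by
  have hψψ : inner ℝ ψ ψ = (1 : ℝ) := by rw [real_inner_self_eq_norm_sq, hψ, one_pow]
  set b := φ - inner ℝ φ ψ • ψ with hb
  have hbψ : inner ℝ b ψ = (0 : ℝ) := by
    rw [hb, inner_sub_left, inner_smul_left, hψψ]; simp
  have hbφ : inner ℝ b φ = ‖b‖ ^ 2 := by
    have : φ = b + inner ℝ φ ψ • ψ := by rw [hb]; abel
    rw [this, inner_add_right, inner_smul_right, hbψ, real_inner_self_eq_norm_sq]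
    simp
  have hb1 : ‖b‖ ≤ 1 := by
    have h := real_inner_le_norm b φ
    rw [hbφ, hφ, mul_one, sq] at h
    by_contra! hlt
    nlinarith
  rw [le_div_iff₀ hc]
  rcases le_or_gt δ (c / 2) with h | h
  · obtain ⟨θ', hθ', hle⟩ := exists_eigenvalue_ge hS hV hψ
    have h1 : c - δ ≤ inner ℝ (S ψ) ψ := by
      have h2 : inner ℝ (T ψ) ψ = c := by rw [hT, inner_smul_left, hψψ]; simp
      have h3 := (abs_real_inner_le_norm (S ψ - T ψ) ψ).trans
        (mul_le_mul_of_nonneg_right (hδ ψ) (norm_nonneg _))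
      rw [inner_sub_left, h2, hψ, mul_one, mul_one] at h3
      linarith [(abs_le.1 h3).1]
    have h4 : c / 2 ≤ θ := by linarith [hmax θ' hθ']
    have h5 := (real_inner_le_norm b (S φ - T φ)).trans
      (mul_le_mul_of_nonneg_left (hδ φ) (norm_nonneg b))
    rw [inner_sub_right, hθ, hT, inner_smul_right, inner_smul_right, hbψ, hbφ, hφ, mul_zero,
      sub_zero, mul_one] at h5
    rcases (norm_nonneg b).eq_or_lt with h0 | h0
    · rw [← h0, zero_mul]
      have := (norm_nonneg _).trans (hδ φ)
      rw [hφ, mul_one] at this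
      linarith
    · have h6 : θ * ‖b‖ ≤ δ := by
        refine le_of_mul_le_mul_left ?_ h0
        linarith
      nlinarith
  · nlinarith

/-- Put `φ = a ψ + b` with `b ⊥ ψ` and `a² + ‖b‖² = 1`. The coefficient `a² - 1` is `-‖b‖²`, so each
of the four terms of the expanded difference carries a factor `‖b‖`. Nothing requires `φ` to be
close to `ψ` rather than to `-ψ`. -/
theorem norm_projection_sub_le {ψ φ : E} (hψ : ‖ψ‖ = 1) (hφ : ‖φ‖ = 1) (f : E) :
    ‖inner ℝ f φ • φ - inner ℝ f ψ • ψ‖ ≤ 4 * ‖φ - inner ℝ φ ψ • ψ‖ * ‖f‖ := by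
  have hψψ : inner ℝ ψ ψ = (1 : ℝ) := by rw [real_inner_self_eq_norm_sq, hψ, one_pow]
  set a : ℝ := inner ℝ φ ψ with ha
  set b := φ - a • ψ with hb
  have hφb : φ = a • ψ + b := by rw [hb]; abel
  have hbψ : inner ℝ b ψ = (0 : ℝ) := by
    rw [hb, inner_sub_left, inner_smul_left, hψψ]; simp [ha]
  have hψb : inner ℝ ψ b = (0 : ℝ) := by rw [real_inner_comm, hbψ]
  have hab : a ^ 2 + ‖b‖ ^ 2 = 1 := by
    have h : inner ℝ φ φ = (1 : ℝ) := by rw [real_inner_self_eq_norm_sq, hφ, one_pow]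
    rw [hφb, inner_add_left, inner_add_right, inner_add_right, inner_smul_left, inner_smul_left,
      inner_smul_right, inner_smul_right, hψψ, hbψ, hψb, real_inner_self_eq_norm_sq] at h
    simp only [conj_trivial] at h
    linarith
  have ha1 : |a| ≤ 1 := abs_le_one_iff_mul_self_le_one.2 (by nlinarith [sq_nonneg ‖b‖])
  have hb1 : ‖b‖ ≤ 1 := by nlinarith [sq_nonneg a, norm_nonneg b]
  have e : inner ℝ f φ • φ - inner ℝ f ψ • ψ = (-(‖b‖ ^ 2 * inner ℝ f ψ)) • ψ +
      (a * inner ℝ f b) • ψ + (a * inner ℝ f ψ) • b + (inner ℝ f b) • b := by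
    have h2 : ‖b‖ ^ 2 = 1 - a ^ 2 := by linarith
    rw [h2, hφb, inner_add_right, inner_smul_right]
    module
  have i1 : |inner ℝ f ψ| ≤ ‖f‖ := by
    simpa [hψ] using abs_real_inner_le_norm f ψ
  have i2 : |inner ℝ f b| ≤ ‖f‖ * ‖b‖ := abs_real_inner_le_norm f b
  have hf := norm_nonneg f
  have hb0 := norm_nonneg b
  rw [e]
  have n1 : ‖(-(‖b‖ ^ 2 * inner ℝ f ψ)) • ψ‖ ≤ ‖b‖ * ‖f‖ := by
    rw [norm_smul, hψ, mul_one, norm_neg, norm_mul, norm_pow, norm_norm, Real.norm_eq_abs]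
    refine mul_le_mul ?_ i1 (abs_nonneg _) hb0
    nlinarith
  have n2 : ‖(a * inner ℝ f b) • ψ‖ ≤ ‖b‖ * ‖f‖ := by
    rw [norm_smul, hψ, mul_one, norm_mul, Real.norm_eq_abs, Real.norm_eq_abs, mul_comm ‖b‖]
    exact (mul_le_mul ha1 i2 (abs_nonneg _) zero_le_one).trans (by rw [one_mul])
  have n3 : ‖(a * inner ℝ f ψ) • b‖ ≤ ‖b‖ * ‖f‖ := by
    rw [norm_smul, norm_mul, Real.norm_eq_abs, Real.norm_eq_abs, mul_comm ‖b‖]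
    refine mul_le_mul_of_nonneg_right ?_ hb0
    exact (mul_le_mul ha1 i1 (abs_nonneg _) zero_le_one).trans (by rw [one_mul])
  have n4 : ‖(inner ℝ f b) • b‖ ≤ ‖b‖ * ‖f‖ := by
    rw [norm_smul, Real.norm_eq_abs, mul_comm ‖b‖]
    refine mul_le_mul_of_nonneg_right (i2.trans ?_) hb0
    nlinarith
  refine (norm_add_le_of_le (norm_add_le_of_le (norm_add_le_of_le n1 n2) n3) n4).trans ?_
  linarith

/-- A positive symmetric operator with the same range closure as an operator of rank one is
`f ↦ c ⟨f, ψ⟩ ψ` with `c > 0`, where `ψ` is its leading unit eigenvector. -/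
theorem eq_smul_of_rank_one {T S : E →ₗ[ℝ] E} (hT : T.IsSymmetric)
    (hpos : ∀ f, 0 ≤ inner ℝ (T f) f) (hS : LinearMap.rank S = 1)
    (hTS : closure (T.range : Set E) = closure (S.range : Set E)) {ψ : E} (hψ : ‖ψ‖ = 1)
    {θ : ℝ} (hθ : T ψ = θ • ψ) (hmax : ∀ θ', Module.End.HasEigenvalue T θ' → θ' ≤ θ) :
    0 < θ ∧ (∀ f, T f = (θ * inner ℝ f ψ) • ψ) ∧ ∀ f, ∃ a : ℝ, S f = a • ψ := by
  have hfin : FiniteDimensional ℝ S.range := Module.finite_of_rank_eq_one hS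
  obtain ⟨w, hw0, hw⟩ := finrank_eq_one_iff'.1 (Module.rank_eq_one_iff_finrank_eq_one.1 hS)
  have hSw : ∀ f, ∃ a : ℝ, S f = a • (w : E) := fun f => by
    obtain ⟨a, ha⟩ := hw ⟨S f, f, rfl⟩
    exact ⟨a, (congrArg Subtype.val ha).symm⟩
  -- A finite-dimensional range is closed, so the equality of closures places the range of `T`
  -- inside the line spanned by `w`.
  have hclS : closure (S.range : Set E) = S.range := (S.range.closed_of_finiteDimensional).closure_eq
  have hTw : ∀ f, ∃ a : ℝ, T f = a • (w : E) := fun f => by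
    have : T f ∈ closure (S.range : Set E) := hTS ▸ subset_closure ⟨f, rfl⟩
    rw [hclS] at this
    obtain ⟨g, hg⟩ := this
    rw [← hg]
    exact hSw g
  have hw0' : (w : E) ≠ 0 := fun h => hw0 (Subtype.ext h)
  have hT0 : ∃ f, T f ≠ 0 := by
    by_contra! h
    have hr : (T.range : Set E) = {0} := by
      ext y
      constructor
      · rintro ⟨f, rfl⟩; exact h f
      · rintro rfl; exact T.range.zero_mem
    have : (w : E) ∈ closure (T.range : Set E) := by rw [hTS]; exact subset_closure w.2
    rw [hr, closure_singleton] at this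
    exact hw0' this
  have hww : 0 < inner ℝ (w : E) (w : E) := real_inner_self_pos.2 hw0'
  obtain ⟨c, hc⟩ := hTw w
  -- Symmetry fixes the coefficient of `T f`; the factor `⟨w,w⟩` is kept because `w` is not
  -- normalised.
  have hTf : ∀ f, inner ℝ (w : E) (w : E) • T f = (c * inner ℝ f (w : E)) • (w : E) := fun f => by
    obtain ⟨a, ha⟩ := hTw f
    have h := hT f w
    rw [ha, hc, inner_smul_left, inner_smul_right] at h
    simp only [conj_trivial] at h
    rw [ha, smul_smul, ← h, mul_comm]
  have hc0 : c ≠ 0 := by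
    rintro rfl
    obtain ⟨f, hf⟩ := hT0
    have := hTf f
    rw [zero_mul, zero_smul, smul_eq_zero] at this
    exact this.elim hww.ne' hf
  have hcpos : 0 < c := by
    have h := hpos w
    rw [hc, inner_smul_left] at h
    exact lt_of_le_of_ne (nonneg_of_mul_nonneg_left h hww) hc0.symm
  -- The line of `w` carries a positive eigenvalue, so the largest one is positive; then `ψ = θ⁻¹ T
  -- ψ` is itself in the range and spans the same line.
  have hcθ : c ≤ θ := hmax c (Module.End.hasEigenvalue_of_hasEigenvector (x := (w : E))
    ⟨Module.End.mem_eigenspace_iff.2 hc, hw0'⟩)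
  have hθ0 : 0 < θ := hcpos.trans_le hcθ
  obtain ⟨a, ha⟩ := hTw ψ
  have hψw : ψ = (θ⁻¹ * a) • (w : E) := by
    rw [mul_smul, ← ha, hθ, smul_smul, inv_mul_cancel₀ hθ0.ne', one_smul]
  set d := θ⁻¹ * a with hd
  have hψ0 : ψ ≠ 0 := by rintro rfl; simp at hψ
  have hd0 : d ≠ 0 := by
    intro h
    rw [h, zero_smul] at hψw
    exact hψ0 hψw
  have hwψ : (w : E) = d⁻¹ • ψ := by rw [hψw, smul_smul, inv_mul_cancel₀ hd0, one_smul]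
  refine ⟨hθ0, fun f => ?_, fun f => ?_⟩
  · obtain ⟨e, he⟩ := hTw f
    rw [hwψ, smul_smul] at he
    have h := hT f ψ
    rw [he, hθ, inner_smul_left, inner_smul_right, real_inner_self_eq_norm_sq, hψ] at h
    simp only [conj_trivial, one_pow, mul_one] at h
    rw [he, h]
  · obtain ⟨e, he⟩ := hSw f
    exact ⟨e * d⁻¹, by rw [he, hwψ, smul_smul]⟩

end Hilbert

/-! ### Covariance inequalities under ψ-mixing and mean squares of averages. -/

section MixingBounds

/-- One variable at a time: for fixed `T` the inequality compares two measures in `S`, so `u` may be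
integrated; the results compare two measures in `T`, so `v` may be integrated. No finiteness is
required. -/
theorem lintegral_mul_le_of_prod_le {α β : Type*} [MeasurableSpace α] [MeasurableSpace β]
    {J K : Measure (α × β)}
    (h : ∀ S T, MeasurableSet S → MeasurableSet T → J (S ×ˢ T) ≤ K (S ×ˢ T))
    {u : α → ℝ≥0∞} {v : β → ℝ≥0∞} (hu : Measurable u) (hv : Measurable v) :
    ∫⁻ z, u z.1 * v z.2 ∂J ≤ ∫⁻ z, u z.1 * v z.2 ∂K := by
  have h1 : ∀ T, MeasurableSet T →
      ∫⁻ z in Prod.snd ⁻¹' T, u z.1 ∂J ≤ ∫⁻ z in Prod.snd ⁻¹' T, u z.1 ∂K := fun T hT => by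
    rw [← lintegral_map hu measurable_fst, ← lintegral_map hu measurable_fst]
    refine lintegral_mono' (Measure.le_iff.2 fun S hS => ?_) le_rfl
    rw [Measure.map_apply measurable_fst hS, Measure.map_apply measurable_fst hS,
      Measure.restrict_apply (measurable_fst hS), Measure.restrict_apply (measurable_fst hS)]
    exact h S T hS hT
  have hu' : Measurable fun z : α × β => u z.1 := hu.comp measurable_fst
  have hv' : Measurable fun z : α × β => v z.2 := hv.comp measurable_snd
  have e : ∀ L : Measure (α × β), ∫⁻ z, u z.1 * v z.2 ∂L =
      ∫⁻ y, v y ∂((L.withDensity fun z => u z.1).map Prod.snd) := fun L => by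
    rw [lintegral_map hv measurable_snd, lintegral_withDensity_eq_lintegral_mul _ hu' hv']
    rfl
  rw [e, e]
  refine lintegral_mono' (Measure.le_iff.2 fun T hT => ?_) le_rfl
  rw [Measure.map_apply measurable_snd hT, Measure.map_apply measurable_snd hT,
    withDensity_apply _ (measurable_snd hT), withDensity_apply _ (measurable_snd hT)]
  exact h1 T hT

variable {Ω : Type*} [MeasurableSpace Ω] {P : Measure Ω}

theorem lintegral_ofReal_map_prod {U V : Ω → ℝ} (hU : Measurable U) (hV : Measurable V)
    (hU0 : ∀ ω, 0 ≤ U ω) (hV0 : ∀ ω, 0 ≤ V ω) (hUV : Integrable (fun ω => U ω * V ω) P) :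
    ∫⁻ z, ENNReal.ofReal z.1 * ENNReal.ofReal z.2 ∂(P.map fun ω => (U ω, V ω)) =
      ENNReal.ofReal (∫ ω, U ω * V ω ∂P) := by
  rw [lintegral_map (by fun_prop) (hU.prodMk hV),
    ofReal_integral_eq_lintegral_ofReal hUV
      (Eventually.of_forall fun ω => mul_nonneg (hU0 ω) (hV0 ω))]
  exact lintegral_congr fun ω => (ENNReal.ofReal_mul (hU0 ω)).symm

/-- The truncated `ψ`-mixing coefficient `min(1, Ψ(k))`. -/
noncomputable def truncPsi (P : Measure Ω) (m : ℕ → MeasurableSpace Ω) (k : ℕ) : ℝ :=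
  (min 1 (psiCoeff P m k)).toReal

theorem truncPsi_nonneg (m : ℕ → MeasurableSpace Ω) (k : ℕ) : 0 ≤ truncPsi P m k :=
  ENNReal.toReal_nonneg

/-- For `k ≥ 1`, `min 1 Ψ ≤ Ψ^{1/2} ≤ k Ψ^{1/2}`. The index `k = 0` has weight zero in the series,
and the truncation supplies the bound 1 for it. -/
theorem exists_sum_truncPsi_le {m : ℕ → MeasurableSpace Ω}
    (h : ∑' k : ℕ, (k : ℝ≥0∞) * psiCoeff P m k ^ (1 / 2 : ℝ) < ∞) :
    ∃ G : ℝ, 0 ≤ G ∧ ∀ N, ∑ k ∈ Finset.range N, truncPsi P m k ≤ G := by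
  set B := ∑' k : ℕ, (k : ℝ≥0∞) * psiCoeff P m k ^ (1 / 2 : ℝ) with hB
  refine ⟨1 + B.toReal, by positivity, fun N => ?_⟩
  have hk : ∀ k, min 1 (psiCoeff P m k) ≤
      (if k = 0 then 1 else 0) + (k : ℝ≥0∞) * psiCoeff P m k ^ (1 / 2 : ℝ) := fun k => by
    rcases Nat.eq_zero_or_pos k with rfl | hk
    · simp
    · have h1 : min 1 (psiCoeff P m k) ≤ psiCoeff P m k ^ (1 / 2 : ℝ) := by
        rcases le_or_gt 1 (psiCoeff P m k) with h | h
        · exact (min_le_left _ _).trans (ENNReal.one_le_rpow h (by norm_num))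
        · rw [min_eq_right h.le]
          nth_rewrite 1 [← ENNReal.rpow_one (psiCoeff P m k)]
          exact ENNReal.rpow_le_rpow_of_exponent_ge h.le (by norm_num)
      rw [if_neg hk.ne', zero_add]
      refine h1.trans (le_mul_of_one_le_left' ?_)
      exact_mod_cast hk
  have hs : ∑ k ∈ Finset.range N, min 1 (psiCoeff P m k) ≤ 1 + B := by
    refine (Finset.sum_le_sum fun k _ => hk k).trans ?_
    rw [Finset.sum_add_distrib]
    refine add_le_add ?_ (ENNReal.sum_le_tsum _)
    rw [Finset.sum_ite_eq' (Finset.range N) 0 fun _ => (1 : ℝ≥0∞)]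
    split_ifs <;> simp
  have h2 := ENNReal.toReal_mono (by finiteness) hs
  rw [ENNReal.toReal_add (by simp) h.ne, ENNReal.toReal_one, ENNReal.toReal_sum fun k _ =>
    ((min_le_left _ _).trans_lt ENNReal.one_lt_top).ne] at h2
  exact h2

variable [IsProbabilityMeasure P]

theorem lintegral_ofReal_prod_map {U V : Ω → ℝ} (hU : Measurable U) (hV : Measurable V)
    (hU0 : ∀ ω, 0 ≤ U ω) (hV0 : ∀ ω, 0 ≤ V ω) (hUi : Integrable U P) (hVi : Integrable V P) :
    ∫⁻ z, ENNReal.ofReal z.1 * ENNReal.ofReal z.2 ∂((P.map U).prod (P.map V)) =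
      ENNReal.ofReal ((∫ ω, U ω ∂P) * ∫ ω, V ω ∂P) := by
  have : IsProbabilityMeasure (P.map U) := Measure.isProbabilityMeasure_map hU.aemeasurable
  have : IsProbabilityMeasure (P.map V) := Measure.isProbabilityMeasure_map hV.aemeasurable
  rw [lintegral_prod_mul (by fun_prop) (by fun_prop), lintegral_map (by fun_prop) hU,
    lintegral_map (by fun_prop) hV, ENNReal.ofReal_mul (integral_nonneg hU0),
    ofReal_integral_eq_lintegral_ofReal hUi (Eventually.of_forall hU0),
    ofReal_integral_eq_lintegral_ofReal hVi (Eventually.of_forall hV0)]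

/-- On rectangles the joint law `J` and the product law `K` satisfy `J ≤ (1 + c) K` and `K ≤ J + c
K`; integrate the product of the coordinates. The second form avoids the factor `1 - c`, which may
be negative. -/
theorem abs_integral_mul_sub_le {U V : Ω → ℝ} (hU : Measurable U) (hV : Measurable V)
    (hU0 : ∀ ω, 0 ≤ U ω) (hV0 : ∀ ω, 0 ≤ V ω) (hUi : Integrable U P) (hVi : Integrable V P)
    (hUV : Integrable (fun ω => U ω * V ω) P) {c : ℝ} (hc : 0 ≤ c)
    (h : ∀ S T, MeasurableSet S → MeasurableSet T →
      |P.real (U ⁻¹' S ∩ V ⁻¹' T) - P.real (U ⁻¹' S) * P.real (V ⁻¹' T)| ≤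
        c * (P.real (U ⁻¹' S) * P.real (V ⁻¹' T))) :
    |(∫ ω, U ω * V ω ∂P) - (∫ ω, U ω ∂P) * ∫ ω, V ω ∂P| ≤
      c * ((∫ ω, U ω ∂P) * ∫ ω, V ω ∂P) := by
  have : IsProbabilityMeasure (P.map U) := Measure.isProbabilityMeasure_map hU.aemeasurable
  have : IsProbabilityMeasure (P.map V) := Measure.isProbabilityMeasure_map hV.aemeasurable
  set J := P.map fun ω => (U ω, V ω) with hJ
  set K := (P.map U).prod (P.map V) with hK
  have eJ : ∀ S T, MeasurableSet S → MeasurableSet T →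
      J (S ×ˢ T) = ENNReal.ofReal (P.real (U ⁻¹' S ∩ V ⁻¹' T)) := fun S T hS hT => by
    rw [hJ, Measure.map_apply (hU.prodMk hV) (hS.prod hT), ofReal_measureReal]
    rfl
  have eK : ∀ S T, MeasurableSet S → MeasurableSet T →
      K (S ×ˢ T) = ENNReal.ofReal (P.real (U ⁻¹' S) * P.real (V ⁻¹' T)) := fun S T hS hT => by
    rw [hK, Measure.prod_prod, Measure.map_apply hU hS, Measure.map_apply hV hT,
      ENNReal.ofReal_mul measureReal_nonneg, ofReal_measureReal, ofReal_measureReal]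
  have IJ := lintegral_ofReal_map_prod hU hV hU0 hV0 hUV
  have IK := lintegral_ofReal_prod_map hU hV hU0 hV0 hUi hVi
  have hp : 0 ≤ (∫ ω, U ω ∂P) * ∫ ω, V ω ∂P :=
    mul_nonneg (integral_nonneg hU0) (integral_nonneg hV0)
  have hq : 0 ≤ ∫ ω, U ω * V ω ∂P := integral_nonneg fun ω => mul_nonneg (hU0 ω) (hV0 ω)
  have h1 := lintegral_mul_le_of_prod_le (J := J) (K := ENNReal.ofReal (1 + c) • K)
    (fun S T hS hT => by
      rw [Measure.smul_apply, eJ S T hS hT, eK S T hS hT, smul_eq_mul,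
        ← ENNReal.ofReal_mul (by positivity)]
      refine ENNReal.ofReal_le_ofReal ?_
      linarith [(abs_le.1 (h S T hS hT)).2]) ENNReal.measurable_ofReal ENNReal.measurable_ofReal
  have h2 := lintegral_mul_le_of_prod_le (J := K) (K := J + ENNReal.ofReal c • K)
    (fun S T hS hT => by
      rw [Measure.add_apply, Measure.smul_apply, eJ S T hS hT, eK S T hS hT, smul_eq_mul,
        ← ENNReal.ofReal_mul hc, ← ENNReal.ofReal_add measureReal_nonneg (by positivity)]
      refine ENNReal.ofReal_le_ofReal ?_
      linarith [(abs_le.1 (h S T hS hT)).1]) ENNReal.measurable_ofReal ENNReal.measurable_ofReal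
  rw [lintegral_smul_measure, IJ, IK, smul_eq_mul, ← ENNReal.ofReal_mul (by positivity),
    ENNReal.ofReal_le_ofReal_iff (by positivity)] at h1
  rw [lintegral_add_measure, lintegral_smul_measure, IJ, IK, smul_eq_mul, ← ENNReal.ofReal_mul hc,
    ← ENNReal.ofReal_add hq (by positivity), ENNReal.ofReal_le_ofReal_iff (by positivity)] at h2
  rw [abs_le]
  constructor <;> linarith

theorem memLp_of_abs_le {U : Ω → ℝ} (hU : Measurable U) {c : ℝ} (hc : ∀ ω, |U ω| ≤ c)
    (r : ℝ≥0∞) : MemLp U r P :=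
  MemLp.of_bound hU.aestronglyMeasurable c (Eventually.of_forall hc)

theorem abs_integral_le_of_abs_le {U : Ω → ℝ} {c : ℝ} (hc : ∀ ω, |U ω| ≤ c) :
    |∫ ω, U ω ∂P| ≤ c := by
  have h := norm_integral_le_of_norm_le_const (μ := P) (f := U) (Eventually.of_forall hc)
  rwa [probReal_univ, mul_one] at h

theorem abs_covariance_le {U V : Ω → ℝ} (hU1 : ∀ ω, |U ω| ≤ 1) (hV1 : ∀ ω, |V ω| ≤ 1) :
    |cov[U, V; P]| ≤ 4 := by
  refine abs_integral_le_of_abs_le fun ω => ?_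
  have hu := abs_integral_le_of_abs_le (P := P) hU1
  have hv := abs_integral_le_of_abs_le (P := P) hV1
  rw [abs_mul]
  calc _ ≤ (2 : ℝ) * 2 := mul_le_mul ((abs_sub _ _).trans (by linarith [hU1 ω]))
        ((abs_sub _ _).trans (by linarith [hV1 ω])) (abs_nonneg _) zero_le_two
    _ = 4 := by norm_num

/-- Adding 1 makes both variables nonnegative without changing their covariance; the shifted means
are at most 2, hence the factor 4. -/
theorem abs_covariance_le_of_mixing {U V : Ω → ℝ} (hU : Measurable U) (hV : Measurable V)
    (hU1 : ∀ ω, |U ω| ≤ 1) (hV1 : ∀ ω, |V ω| ≤ 1) {c : ℝ} (hc : 0 ≤ c)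
    (h : ∀ S T, MeasurableSet S → MeasurableSet T →
      |P.real (U ⁻¹' S ∩ V ⁻¹' T) - P.real (U ⁻¹' S) * P.real (V ⁻¹' T)| ≤
        c * (P.real (U ⁻¹' S) * P.real (V ⁻¹' T))) :
    |cov[U, V; P]| ≤ 4 * c := by
  have iU : Integrable U P := (memLp_of_abs_le hU hU1 1).integrable le_rfl
  have iV : Integrable V P := (memLp_of_abs_le hV hV1 1).integrable le_rfl
  have hU' : ∀ ω, 0 ≤ U ω + 1 := fun ω => by linarith [(abs_le.1 (hU1 ω)).1]
  have hV' : ∀ ω, 0 ≤ V ω + 1 := fun ω => by linarith [(abs_le.1 (hV1 ω)).1]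
  have hU2 : ∀ ω, |U ω + 1| ≤ 2 := fun ω => by
    rw [abs_of_nonneg (hU' ω)]; linarith [(abs_le.1 (hU1 ω)).2]
  have hV2 : ∀ ω, |V ω + 1| ≤ 2 := fun ω => by
    rw [abs_of_nonneg (hV' ω)]; linarith [(abs_le.1 (hV1 ω)).2]
  have mU : MemLp (fun ω => U ω + 1) 2 P := memLp_of_abs_le (hU.add_const 1) hU2 2
  have mV : MemLp (fun ω => V ω + 1) 2 P := memLp_of_abs_le (hV.add_const 1) hV2 2
  have e : cov[U, V; P] = cov[fun ω => U ω + 1, fun ω => V ω + 1; P] := by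
    rw [covariance_add_const_left iU, covariance_add_const_right iV]
  have key := abs_integral_mul_sub_le (hU.add_const 1) (hV.add_const 1) hU' hV'
    (iU.add (integrable_const 1)) (iV.add (integrable_const 1)) (mU.integrable_mul mV) hc
    fun S T hS hT => h ((· + 1) ⁻¹' S) ((· + 1) ⁻¹' T) (measurable_add_const 1 hS)
      (measurable_add_const 1 hT)
  rw [e, covariance_eq_sub mU mV]
  refine key.trans ?_
  have a1 := (le_abs_self _).trans (abs_integral_le_of_abs_le (P := P) hU2)
  have a2 := (le_abs_self _).trans (abs_integral_le_of_abs_le (P := P) hV2)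
  have := mul_le_mul a1 a2 (integral_nonneg hV') zero_le_two
  nlinarith

theorem abs_measureReal_inter_sub_le {m : ℕ → MeasurableSpace Ω} {j k : ℕ} (hj : 1 ≤ j)
    (hk : psiCoeff P m k ≠ ∞) {A B : Set Ω} (hA : MeasurableSet[⨆ t ∈ Icc 1 j, m t] A)
    (hB : MeasurableSet[⨆ t ∈ Ici (j + k), m t] B) :
    |P.real (A ∩ B) - P.real A * P.real B| ≤
      (psiCoeff P m k).toReal * (P.real A * P.real B) := by
  have h0 : 0 ≤ P.real A * P.real B := by positivity
  rcases h0.eq_or_lt with h | h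
  · have : P.real (A ∩ B) = 0 := by
      rcases mul_eq_zero.1 h.symm with h' | h'
      · exact le_antisymm (h' ▸ measureReal_mono inter_subset_left) measureReal_nonneg
      · exact le_antisymm (h' ▸ measureReal_mono inter_subset_right) measureReal_nonneg
    rw [this, ← h]; simp
  · have h1 : ENNReal.ofReal |P.real (A ∩ B) / (P.real A * P.real B) - 1| ≤ psiCoeff P m k := by
      unfold psiCoeff
      exact le_iSup_of_le j (le_iSup_of_le hj (le_iSup_of_le A (le_iSup_of_le B
        (le_iSup_of_le hA (le_iSup_of_le hB (le_iSup_of_le h le_rfl))))))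
    have h2 := (ENNReal.ofReal_le_iff_le_toReal hk).1 h1
    have e : P.real (A ∩ B) - P.real A * P.real B =
        (P.real (A ∩ B) / (P.real A * P.real B) - 1) * (P.real A * P.real B) := by
      rw [sub_mul, div_mul_cancel₀ _ h.ne', one_mul]
    rw [e, abs_mul, abs_of_pos h]
    exact mul_le_mul_of_nonneg_right h2 h.le

/-- Where the coefficient is at least 1, possibly infinite, the trivial bound 4 is already enough;
this is why truncation costs nothing. -/
theorem abs_covariance_le_truncPsi {m : ℕ → MeasurableSpace Ω} {j k : ℕ} (hj : 1 ≤ j)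
    {U V : Ω → ℝ} (hU : Measurable U) (hV : Measurable V)
    (hUm : Measurable[⨆ t ∈ Icc 1 j, m t] U) (hVm : Measurable[⨆ t ∈ Ici (j + k), m t] V)
    (hU1 : ∀ ω, |U ω| ≤ 1) (hV1 : ∀ ω, |V ω| ≤ 1) :
    |cov[U, V; P]| ≤ 4 * truncPsi P m k := by
  unfold truncPsi
  rcases le_or_gt 1 (psiCoeff P m k) with h | h
  · rw [min_eq_left h, ENNReal.toReal_one, mul_one]
    exact abs_covariance_le hU1 hV1
  · rw [min_eq_right h.le]
    exact abs_covariance_le_of_mixing hU hV hU1 hV1 ENNReal.toReal_nonneg fun S T hS hT =>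
      abs_measureReal_inter_sub_le hj h.ne_top (hUm hS) (hVm hT)

/-- Mean-square bound for averages of weakly correlated variables. -/
theorem integral_average_sub_sq_le {Z : ℕ → Ω → ℝ} (hZ : ∀ t, Measurable (Z t))
    (hZ1 : ∀ t ω, |Z t ω| ≤ 1) {z : ℝ} {N : ℕ} (hN : 0 < N)
    (hz : ∀ t, 1 ≤ t → ∫ ω, Z t ω ∂P = z) {g : ℕ → ℝ} {G : ℝ}
    (hg0 : ∀ d, 0 ≤ g d) (hG : ∀ M, ∑ d ∈ Finset.range M, g d ≤ G)
    (hg : ∀ s d, 1 ≤ s → |cov[Z s, Z (s + d); P]| ≤ g d) :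
    ∫ ω, ((N : ℝ)⁻¹ * ∑ t ∈ Finset.Icc 1 N, Z t ω - z) ^ 2 ∂P ≤ 2 * G / N := by
  have mZ : ∀ t, MemLp (Z t) 2 P := fun t => memLp_of_abs_le (hZ t) (hZ1 t) 2
  have hN' : (0 : ℝ) < N := by exact_mod_cast hN
  have e1 : ∀ ω, ((N : ℝ)⁻¹ * ∑ t ∈ Finset.Icc 1 N, Z t ω - z) ^ 2 =
      (N : ℝ)⁻¹ ^ 2 * ∑ s ∈ Finset.Icc 1 N, ∑ t ∈ Finset.Icc 1 N, (Z s ω - z) * (Z t ω - z) := by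
    intro ω
    rw [← Finset.sum_mul_sum, ← sq, ← mul_pow, Finset.sum_sub_distrib]
    simp only [Finset.sum_const, Nat.card_Icc, add_tsub_cancel_right, nsmul_eq_mul]
    congr 1
    field_simp
  have hint : ∀ s t, Integrable (fun ω => (Z s ω - z) * (Z t ω - z)) P := fun s t =>
    ((mZ s).sub (memLp_const z)).integrable_mul ((mZ t).sub (memLp_const z))
  have e2 : ∫ ω, ((N : ℝ)⁻¹ * ∑ t ∈ Finset.Icc 1 N, Z t ω - z) ^ 2 ∂P =
      (N : ℝ)⁻¹ ^ 2 * ∑ s ∈ Finset.Icc 1 N, ∑ t ∈ Finset.Icc 1 N, cov[Z s, Z t; P] := by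
    simp_rw [e1]
    rw [integral_const_mul, integral_finsetSum _ fun s _ => integrable_finsetSum _ fun t _ =>
      hint s t]
    congr 1
    refine Finset.sum_congr rfl fun s hs => ?_
    rw [integral_finsetSum _ fun t _ => hint s t]
    refine Finset.sum_congr rfl fun t ht => ?_
    rw [covariance, hz s (Finset.mem_Icc.1 hs).1, hz t (Finset.mem_Icc.1 ht).1]
  have hrow : ∀ s ∈ Finset.Icc 1 N, ∑ t ∈ Finset.Icc 1 N, cov[Z s, Z t; P] ≤ 2 * G := by
    intro s hs
    have hs1 := (Finset.mem_Icc.1 hs).1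
    -- Split each row into lags to the right and to the left of `s`. The diagonal is counted twice,
    -- harmlessly since `g ≥ 0`, and on each side every lag occurs at most once, whence `2 * G`.
    have hb : ∀ t ∈ Finset.Icc 1 N, cov[Z s, Z t; P] ≤
        (if s ≤ t then g (t - s) else 0) + if t ≤ s then g (s - t) else 0 := by
      intro t ht
      have ht1 := (Finset.mem_Icc.1 ht).1
      rcases le_total s t with hst | hst
      · have h := (le_abs_self _).trans (hg s (t - s) hs1)
        rw [Nat.add_sub_cancel' hst] at h
        rw [if_pos hst]
        refine h.trans (le_add_of_nonneg_right ?_)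
        split_ifs
        exacts [hg0 _, le_rfl]
      · have h := (le_abs_self _).trans (hg t (s - t) ht1)
        rw [Nat.add_sub_cancel' hst, covariance_comm] at h
        rw [if_pos hst]
        refine h.trans (le_add_of_nonneg_left ?_)
        split_ifs
        exacts [hg0 _, le_rfl]
    refine (Finset.sum_le_sum hb).trans ?_
    rw [Finset.sum_add_distrib, two_mul, ← Finset.sum_filter, ← Finset.sum_filter]
    refine add_le_add ?_ ?_
    · refine le_trans ?_ (hG (N + 1))
      rw [← Finset.sum_image (g := fun t => t - s) (f := g)]
      · refine Finset.sum_le_sum_of_subset_of_nonneg ?_ fun d _ _ => hg0 d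
        intro d hd
        simp only [Finset.mem_image, Finset.mem_filter, Finset.mem_Icc, Finset.mem_range] at hd ⊢
        omega
      · intro a ha b hb hab
        simp only [Finset.coe_filter, Finset.mem_Icc, mem_ofPred_eq] at ha hb hab
        omega
    · refine le_trans ?_ (hG (N + 1))
      rw [← Finset.sum_image (g := fun t => s - t) (f := g)]
      · refine Finset.sum_le_sum_of_subset_of_nonneg ?_ fun d _ _ => hg0 d
        intro d hd
        simp only [Finset.mem_image, Finset.mem_filter, Finset.mem_Icc, Finset.mem_range] at hd ⊢
        have := Finset.mem_Icc.1 hs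
        omega
      · intro a ha b hb hab
        simp only [Finset.coe_filter, Finset.mem_Icc, mem_ofPred_eq] at ha hb hab
        omega
  rw [e2]
  refine (mul_le_mul_of_nonneg_left (Finset.sum_le_sum hrow) (by positivity)).trans (le_of_eq ?_)
  simp only [Finset.sum_const, Nat.card_Icc, add_tsub_cancel_right, nsmul_eq_mul]
  field_simp

/-- The mean-square bound for averages of functions of finitely many consecutive terms of a
mixing sequence. -/
theorem integral_average_sub_sq_le_of_mixing {m : ℕ → MeasurableSpace Ω} {G : ℝ}
    (hG : ∀ N, ∑ k ∈ Finset.range N, truncPsi P m k ≤ G) (k : ℕ) {Z : ℕ → Ω → ℝ}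
    (hZ : ∀ t, Measurable (Z t)) (hZm : ∀ t, 1 ≤ t → Measurable[⨆ s ∈ Icc t (t + k), m s] (Z t))
    (hZ1 : ∀ t ω, |Z t ω| ≤ 1) {z : ℝ} (hz : ∀ t, 1 ≤ t → ∫ ω, Z t ω ∂P = z) {N : ℕ}
    (hN : 0 < N) :
    ∫ ω, ((N : ℝ)⁻¹ * ∑ t ∈ Finset.Icc 1 N, Z t ω - z) ^ 2 ∂P ≤ 8 * (k + G) / N := by
  have h := integral_average_sub_sq_le (P := P) hZ hZ1 hN hz
    -- Windows of length `k` may overlap at lags below `k`, where only the trivial bound is used;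
    -- from lag `k` on they are separated by a gap `d - k`.
    (g := fun d => if d < k then 4 else 4 * truncPsi P m (d - k)) (G := 4 * (k + G))
    (fun d => ?_) (fun M => ?_) fun s d hs => ?_
  · refine h.trans (le_of_eq ?_)
    ring
  · split_ifs
    · norm_num
    · exact mul_nonneg (by norm_num) (truncPsi_nonneg m _)
  · have h0 : ∀ d, 0 ≤ if d < k then (4 : ℝ) else 4 * truncPsi P m (d - k) := fun d => by
      split_ifs
      · norm_num
      · exact mul_nonneg (by norm_num) (truncPsi_nonneg m _)
    refine (Finset.sum_le_sum_of_subset_of_nonneg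
      (Finset.range_mono (Nat.le_add_left M k)) fun d _ _ => h0 d).trans ?_
    rw [Finset.sum_range_add, mul_add]
    refine add_le_add (le_of_eq ?_) ?_
    · rw [Finset.sum_congr rfl fun d hd => if_pos (Finset.mem_range.1 hd)]
      simp [mul_comm]
    · simp only [add_lt_iff_neg_left, not_lt_zero, if_false, add_tsub_cancel_left]
      rw [← Finset.mul_sum]
      exact mul_le_mul_of_nonneg_left (hG M) (by norm_num)
  · split_ifs with hd
    · exact abs_covariance_le (hZ1 _) (hZ1 _)
    · refine abs_covariance_le_truncPsi (j := s + k) (by omega) (hZ _) (hZ _) ?_ ?_ (hZ1 _)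
        (hZ1 _)
      · refine (hZm s hs).mono (biSup_mono fun t ht => ?_) le_rfl
        exact ⟨hs.trans ht.1, ht.2⟩
      · refine (hZm (s + d) (by omega)).mono (biSup_mono fun t ht => ?_) le_rfl
        have := ht.1
        simp only [mem_Ici]
        omega

end MixingBounds

/-! ### Recovering the values `F̂_t(x)` from the class of `F̂_t` in `L²(μ)`. -/

section PointwiseMeasurability

/-- Right neighbourhoods of `x` have positive mass. -/
def IsRightSupported (μ : Measure ℝ) (x : ℝ) : Prop :=
  ∀ h : ℝ, 0 < h → 0 < μ (Ioo x (x + h))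

/-- Interior points of the interval have this property, and the frontier of a convex set is
Lebesgue-null, hence `μ`-null. -/
theorem IsDiffraction.ae_isRightSupported {Ω : Type*} [MeasurableSpace Ω] {P : Measure Ω}
    {ξ : ℕ → Ω → ProbabilityMeasure ℝ} {μ : Measure ℝ} (hμ : IsDiffraction P ξ μ) :
    ∀ᵐ x ∂μ, IsRightSupported μ x := by
  obtain ⟨I, hI, -, h1, h2⟩ := hμ
  have hfr : volume (frontier I) = 0 := hI.convex.addHaar_frontier volume
  have hint : ∀ᵐ x ∂(volume.restrict I), x ∈ interior I := by
    have hnull : NullMeasurableSet I := hI.measurableSet.nullMeasurableSet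
    rw [ae_restrict_iff'₀ hnull]
    have h3 : ∀ᵐ x ∂(volume : Measure ℝ), x ∉ frontier I := measure_eq_zero_iff_ae_notMem.1 hfr
    filter_upwards [h3] with x hx hxI
    by_contra hxi
    exact hx ⟨subset_closure hxI, hxi⟩
  filter_upwards [h1.ae_le hint] with x hx h hh
  refine pos_iff_ne_zero.2 fun h0 => ?_
  have h4 := h2 h0
  rw [Measure.restrict_apply measurableSet_Ioo] at h4
  obtain ⟨r, hr, hball⟩ := Metric.isOpen_iff.1 isOpen_interior x hx
  have hsub : Ioo x (x + min h r) ⊆ Ioo x (x + h) ∩ I := fun y hy => by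
    refine ⟨⟨hy.1, hy.2.trans_le (by linarith [min_le_left h r])⟩, interior_subset (hball ?_)⟩
    rw [Metric.mem_ball, Real.dist_eq, abs_of_pos (sub_pos.2 hy.1)]
    linarith [hy.2, min_le_right h r]
  have h5 := measure_mono_null hsub h4
  rw [Real.volume_Ioo, ENNReal.ofReal_eq_zero] at h5
  linarith [lt_min hh hr]

variable {Ω : Type*} {X : ℝ≥0 → Ω → ℝ} {q : ℕ → ℕ} {τ : (t : ℕ) → Fin (q t) → ℝ≥0}

theorem abs_empCdfFun_le_one (t : ℕ) (ω : Ω) (x : ℝ) : |empCdfFun X q τ t ω x| ≤ 1 := by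
  rw [abs_of_nonneg (empCdfFun_nonneg X q τ t ω x)]
  exact empCdfFun_le_one X q τ t ω x

theorem empCdfFun_eventually_eq (t : ℕ) (ω : Ω) (x : ℝ) :
    ∃ h : ℝ, 0 < h ∧ ∀ y ∈ Ioo x (x + h), empCdfFun X q τ t ω y = empCdfFun X q τ t ω x := by
  have h1 : ∀ i : Fin (q t), ∀ᶠ y in 𝓝[>] x,
      (Iic y).indicator (fun _ => (1 : ℝ)) (X (τ t i) ω) =
        (Iic x).indicator (fun _ => (1 : ℝ)) (X (τ t i) ω) := fun i => by
    rcases le_or_gt (X (τ t i) ω) x with h | h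
    · filter_upwards [self_mem_nhdsWithin] with y hy
      rw [indicator_of_mem (show X (τ t i) ω ∈ Iic y from h.trans (le_of_lt hy)),
        indicator_of_mem (show X (τ t i) ω ∈ Iic x from h)]
    · filter_upwards [nhdsWithin_le_nhds (Iio_mem_nhds h)] with y hy
      rw [indicator_of_notMem (show X (τ t i) ω ∉ Iic y from not_le.2 (show y < _ from hy)),
        indicator_of_notMem (show X (τ t i) ω ∉ Iic x from not_le.2 (show x < _ from h))]
  have h2 : ∀ᶠ y in 𝓝[>] x, empCdfFun X q τ t ω y = empCdfFun X q τ t ω x := by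
    filter_upwards [eventually_all.2 h1] with y hy
    unfold empCdfFun
    simp_rw [hy]
  obtain ⟨b, hb, hsub⟩ := mem_nhdsGT_iff_exists_Ioo_subset.1 h2
  have hb' : x < b := hb
  exact ⟨b - x, sub_pos.2 hb', fun y hy => hsub (by simpa using hy)⟩

/-- Mixing concerns `L²(μ)` classes, whereas covariances are computed pointwise. An empirical cdf is
constant just to the right of `x`, so its value there is the limit of its averages over `(x, x +
1/(n+1))`, which are continuous functionals on `L²(μ)`. -/
theorem measurable_empCdfFun_empCdfSigma {μ : Measure ℝ} [IsFiniteMeasure μ] {x : ℝ}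
    (hx : IsRightSupported μ x) (t : ℕ) :
    Measurable[empCdfSigma μ X q τ t] fun ω => empCdfFun X q τ t ω x := by
  let I : ℕ → Set ℝ := fun n => Ioo x (x + 1 / ((n : ℝ) + 1))
  let Φ : ℕ → Lp ℝ 2 μ → ℝ := fun n f => (μ.real (I n))⁻¹ *
    inner ℝ (indicatorConstLp 2 (measurableSet_Ioo (a := x) (b := x + 1 / ((n : ℝ) + 1)))
      (measure_ne_top μ _) (1 : ℝ)) f
  have hΦ : ∀ n, Measurable[borel (Lp ℝ 2 μ)] (Φ n) := fun n => by
    let _ : MeasurableSpace (Lp ℝ 2 μ) := borel _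
    have : BorelSpace (Lp ℝ 2 μ) := ⟨rfl⟩
    have : Continuous (Φ n) := by unfold Φ; fun_prop
    exact this.measurable
  refine @measurable_of_tendsto_metrizable Ω ℝ (empCdfSigma μ X q τ t) _ _ _ _
    (fun n ω => Φ n (empCdf μ X q τ t ω)) _ (fun n => ?_) ?_
  · exact (hΦ n).comp (comap_measurable _)
  · rw [tendsto_pi_nhds]
    intro ω
    obtain ⟨h, hh, heq⟩ := empCdfFun_eventually_eq (X := X) (q := q) (τ := τ) t ω x
    refine tendsto_const_nhds.congr' ?_
    filter_upwards [tendsto_one_div_add_atTop_nhds_zero_nat.eventually (gt_mem_nhds hh)]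
      with n hn
    have hpos : μ.real (I n) ≠ 0 :=
      (ENNReal.toReal_pos (hx _ (by positivity)).ne' (measure_ne_top μ _)).ne'
    change _ = (μ.real (I n))⁻¹ * _
    rw [L2.inner_indicatorConstLp_one]
    have e : ∫ y in I n, (empCdf μ X q τ t ω : ℝ → ℝ) y ∂μ =
        ∫ y in I n, empCdfFun X q τ t ω x ∂μ := by
      refine setIntegral_congr_ae measurableSet_Ioo ?_
      filter_upwards [(memLp_empCdfFun μ X q τ t ω).coeFn_toLp] with y hy hyI
      rw [empCdf, hy]
      exact heq y ⟨hyI.1, hyI.2.trans (by linarith)⟩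
    rw [e, setIntegral_const, smul_eq_mul, inv_mul_cancel_left₀ hpos]

end PointwiseMeasurability

/-! ### First and lagged second moments of the empirical cdfs. -/

section Moments

theorem measureReal_eq_integral_condProb {Ω : Type*} {m m0 : MeasurableSpace Ω} {P : Measure Ω}
    [IsProbabilityMeasure P] (hm : m ≤ m0) {A : Set Ω} (hA : MeasurableSet A) :
    P.real A = ∫ ω, (P⟦A | m⟧) ω ∂P := by
  rw [integral_condExp hm, integral_indicator_const _ hA, smul_eq_mul, mul_one]

variable {Ω : Type*} [MeasurableSpace Ω] {P : Measure Ω} {ξ : ℕ → Ω → ProbabilityMeasure ℝ}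
  {X : ℝ≥0 → Ω → ℝ} {q : ℕ → ℕ} {τ : (t : ℕ) → Fin (q t) → ℝ≥0}

theorem measurable_empCdfFun_uncurry (hX : ∀ s, Measurable (X s)) (t : ℕ) :
    Measurable fun a : ℝ × Ω => empCdfFun X q τ t a.2 a.1 := by
  unfold empCdfFun
  refine Measurable.const_mul (Finset.measurable_fun_sum _ fun i _ => ?_) _
  have hs : MeasurableSet {a : ℝ × Ω | X (τ t i) a.2 ≤ a.1} :=
    measurableSet_le ((hX _).comp measurable_snd) measurable_fst
  exact (measurable_const (a := (1 : ℝ))).indicator hs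

theorem measurable_empMeanFun_uncurry (hX : ∀ s, Measurable (X s)) (n : ℕ) :
    Measurable fun a : ℝ × Ω => empMeanFun X q τ n a.2 a.1 := by
  unfold empMeanFun
  exact Measurable.const_mul
    (Finset.measurable_fun_sum _ fun t _ => measurable_empCdfFun_uncurry hX t) _

theorem measurable_empCdfFun_left (hX : ∀ s, Measurable (X s)) (t : ℕ) (x : ℝ) :
    Measurable fun ω => empCdfFun X q τ t ω x :=
  (measurable_empCdfFun_uncurry hX t).comp (measurable_const.prodMk measurable_id)

theorem measurable_cdf_left {ζ : Ω → ProbabilityMeasure ℝ} (hζ : Measurable ζ) (x : ℝ) :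
    Measurable fun ω => cdf (ζ ω : Measure ℝ) x :=
  (measurable_cdf_uncurry hζ).comp (measurable_const.prodMk measurable_id)

theorem abs_cdf_le_one (ν : Measure ℝ) (x : ℝ) : |cdf ν x| ≤ 1 := by
  rw [abs_of_nonneg (cdf_nonneg _ x)]
  exact cdf_le_one _ x

theorem IsConjugateProcess.latentSigma_le (h : IsConjugateProcess P ξ X) :
    latentSigma ξ ≤ ‹MeasurableSpace Ω› :=
  iSup_le fun t => (h.measurable_latent t).comap_le

theorem IsStationaryLatent.map_shift (h : IsStationaryLatent P ξ) (hξ : ∀ t, Measurable (ξ t))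
    (t : ℕ) : P.map (fun ω (s : ℕ) => ξ (s + t) ω) = P.map (fun ω (s : ℕ) => ξ s ω) := by
  have hm : ∀ t, Measurable fun ω (s : ℕ) => ξ (s + t) ω := fun t =>
    measurable_pi_lambda _ fun s => hξ _
  induction t with
  | zero => rfl
  | succ t ih =>
    have hsh : Measurable fun (v : ℕ → ProbabilityMeasure ℝ) (s : ℕ) => v (s + t) :=
      measurable_pi_lambda _ fun s => measurable_pi_apply _
    have e := congrArg (Measure.map fun (v : ℕ → ProbabilityMeasure ℝ) (s : ℕ) => v (s + t)) h
    rw [Measure.map_map hsh (hm 1), Measure.map_map hsh (measurable_pi_lambda _ fun s => hξ s)] at e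
    refine Eq.trans ?_ (e.trans ih)
    congr 1

theorem IsStationaryLatent.integral_shift (h : IsStationaryLatent P ξ)
    (hξ : ∀ t, Measurable (ξ t)) {f : (ℕ → ProbabilityMeasure ℝ) → ℝ} (hf : Measurable f)
    (t : ℕ) : ∫ ω, f (fun s => ξ (s + t) ω) ∂P = ∫ ω, f (fun s => ξ s ω) ∂P := by
  rw [← integral_map (f := f) (measurable_pi_lambda (fun ω s => ξ (s + t) ω)
      fun s => hξ _).aemeasurable hf.aestronglyMeasurable, h.map_shift hξ t,
    integral_map (measurable_pi_lambda _ fun s => hξ _).aemeasurable hf.aestronglyMeasurable]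

theorem IsStationaryLatent.integral_cdf (h : IsStationaryLatent P ξ)
    (hξ : ∀ t, Measurable (ξ t)) (t : ℕ) (x : ℝ) :
    ∫ ω, cdf (ξ t ω : Measure ℝ) x ∂P = ∫ ω, cdf (ξ 0 ω : Measure ℝ) x ∂P := by
  simpa using h.integral_shift hξ (f := fun v => cdf (v 0 : Measure ℝ) x)
    (measurable_cdf_left (measurable_pi_apply 0) x) t

theorem IsStationaryLatent.integral_cdf_mul (h : IsStationaryLatent P ξ)
    (hξ : ∀ t, Measurable (ξ t)) (t k : ℕ) (x y : ℝ) :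
    ∫ ω, cdf (ξ t ω : Measure ℝ) x * cdf (ξ (t + k) ω : Measure ℝ) y ∂P =
      ∫ ω, cdf (ξ 0 ω : Measure ℝ) x * cdf (ξ k ω : Measure ℝ) y ∂P := by
  simpa [add_comm k t] using h.integral_shift hξ
    (f := fun v => cdf (v 0 : Measure ℝ) x * cdf (v k : Measure ℝ) y)
    ((measurable_cdf_left (measurable_pi_apply 0) x).mul
      (measurable_cdf_left (measurable_pi_apply k) y)) t

theorem IsConjugateProcess.condProb_Iic (h : IsConjugateProcess P ξ X) {t : ℕ} {s : ℝ≥0}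
    (hs : s ∈ cycle t) (x : ℝ) : P⟦X s ⁻¹' Iic x | latentSigma ξ⟧ =ᵐ[P]
      fun ω => cdf (ξ t ω : Measure ℝ) x := by
  filter_upwards [h.compat t s hs (Iic x) measurableSet_Iic] with ω hω
  rw [hω, cdf_eq_real]

variable [IsProbabilityMeasure P]

theorem IsConjugateProcess.measureReal_Iic (h : IsConjugateProcess P ξ X) {t : ℕ} {s : ℝ≥0}
    (hs : s ∈ cycle t) (x : ℝ) :
    P.real (X s ⁻¹' Iic x) = ∫ ω, cdf (ξ t ω : Measure ℝ) x ∂P := by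
  rw [measureReal_eq_integral_condProb h.latentSigma_le (h.measurable_obs s measurableSet_Iic)]
  exact integral_congr_ae (h.condProb_Iic hs x)

/-- Condition on `Ξ`: events in distinct cycles factor, each factor is a value of the latent cdf,
and the product is then averaged. -/
theorem CyclicIndependent.measureReal_Iic_inter (hc : CyclicIndependent P ξ X)
    (h : IsConjugateProcess P ξ X) {t t' : ℕ} (htt : t ≠ t') {s s' : ℝ≥0} (hs : s ∈ cycle t)
    (hs' : s' ∈ cycle t') (x y : ℝ) :
    P.real (X s ⁻¹' Iic x ∩ X s' ⁻¹' Iic y) =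
      ∫ ω, cdf (ξ t ω : Measure ℝ) x * cdf (ξ t' ω : Measure ℝ) y ∂P := by
  rw [measureReal_eq_integral_condProb h.latentSigma_le
    ((h.measurable_obs s measurableSet_Iic).inter (h.measurable_obs s' measurableSet_Iic))]
  have hm : ∀ (r : ℕ) (u : ℝ≥0), u ∈ cycle r → ∀ z, MeasurableSet[cycleSigma X r]
      (X u ⁻¹' Iic z) := fun r u hu z =>
    le_iSup₂ (f := fun (u : ℝ≥0) (_ : u ∈ cycle r) => MeasurableSpace.comap (X u) inferInstance)
      u hu _ ⟨Iic z, measurableSet_Iic, rfl⟩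
  -- The two events are encoded as one family indexed by cycles; only its values at `t` and `t'`
  -- matter.
  have key := hc {t, t'} (fun r => if r = t then X s ⁻¹' Iic x else X s' ⁻¹' Iic y) (by
    intro r hr
    rcases Finset.mem_insert.1 hr with rfl | hr
    · simpa using hm r s hs x
    · rw [Finset.mem_singleton.1 hr]
      simpa [htt.symm] using hm t' s' hs' y)
  simp only [Finset.mem_insert, Finset.mem_singleton, iInter_iInter_eq_or_left,
    iInter_iInter_eq_left, if_true, if_neg htt.symm, Finset.prod_pair htt] at key
  refine integral_congr_ae ?_
  filter_upwards [key, h.condProb_Iic hs x, h.condProb_Iic hs' y] with ω h1 h2 h3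
  rw [h1, Pi.mul_apply, h2, h3]

theorem integral_empCdfFun (h : IsConjugateProcess P ξ X) (hst : IsStationaryLatent P ξ)
    (hq : IsSamplingScheme q τ) {t : ℕ} (ht : 1 ≤ t) (x : ℝ) :
    ∫ ω, empCdfFun X q τ t ω x ∂P = ∫ ω, cdf (ξ 0 ω : Measure ℝ) x ∂P := by
  obtain ⟨hq0, hcyc⟩ := hq t ht
  have hi : ∀ i : Fin (q t), ∀ ω, (Iic x).indicator (fun _ => (1 : ℝ)) (X (τ t i) ω) =
      (X (τ t i) ⁻¹' Iic x).indicator (fun _ => (1 : ℝ)) ω := fun i ω => rfl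
  unfold empCdfFun
  simp_rw [hi]
  have hm := fun i => h.measurable_obs (τ t i) (measurableSet_Iic (a := x))
  rw [integral_const_mul, integral_finsetSum _ fun i _ =>
    (integrable_const (1 : ℝ)).indicator (hm i)]
  simp_rw [fun i => integral_indicator_const (μ := P) (1 : ℝ) (hm i),
    fun i => h.measureReal_Iic (hcyc i) x, hst.integral_cdf h.measurable_latent t x]
  have : (q t : ℝ) ≠ 0 := by exact_mod_cast hq0.ne'
  simp [this]

/-- Expanding both averages leaves only pairs of observations from different cycles, so sampling
noise adds no bias. At lag 0 this would fail, which is why `R` uses lags `k ≥ 1`. -/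
theorem integral_empCdfFun_mul (h : IsConjugateProcess P ξ X) (hst : IsStationaryLatent P ξ)
    (hc : CyclicIndependent P ξ X) (hq : IsSamplingScheme q τ) {t k : ℕ} (ht : 1 ≤ t)
    (hk : 1 ≤ k) (x y : ℝ) :
    ∫ ω, empCdfFun X q τ t ω x * empCdfFun X q τ (t + k) ω y ∂P =
      ∫ ω, cdf (ξ 0 ω : Measure ℝ) x * cdf (ξ k ω : Measure ℝ) y ∂P := by
  obtain ⟨hq0, hcyc⟩ := hq t ht
  obtain ⟨hq0', hcyc'⟩ := hq (t + k) (by omega)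
  have hi : ∀ (i : Fin (q t)) (j : Fin (q (t + k))), ∀ ω,
      (Iic x).indicator (fun _ => (1 : ℝ)) (X (τ t i) ω) *
        (Iic y).indicator (fun _ => (1 : ℝ)) (X (τ (t + k) j) ω) =
      (X (τ t i) ⁻¹' Iic x ∩ X (τ (t + k) j) ⁻¹' Iic y).indicator (fun _ => (1 : ℝ)) ω :=
    fun i j ω => by
      have h := inter_indicator_mul (s := X (τ t i) ⁻¹' Iic x)
        (t := X (τ (t + k) j) ⁻¹' Iic y) (fun _ => (1 : ℝ)) (fun _ => (1 : ℝ)) ω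
      rw [mul_one] at h
      exact h.symm
  have e : ∀ ω, empCdfFun X q τ t ω x * empCdfFun X q τ (t + k) ω y =
      (q t : ℝ)⁻¹ * (q (t + k) : ℝ)⁻¹ * ∑ i, ∑ j,
        (X (τ t i) ⁻¹' Iic x ∩ X (τ (t + k) j) ⁻¹' Iic y).indicator (fun _ => (1 : ℝ)) ω := by
    intro ω
    simp_rw [← hi, ← Finset.sum_mul_sum]
    unfold empCdfFun
    ring
  simp_rw [e]
  have hm := fun i j => (h.measurable_obs (τ t i) (measurableSet_Iic (a := x))).inter
    (h.measurable_obs (τ (t + k) j) (measurableSet_Iic (a := y)))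
  rw [integral_const_mul, integral_finsetSum _ fun i _ => integrable_finsetSum _ fun j _ =>
    (integrable_const (1 : ℝ)).indicator (hm i j)]
  simp_rw [fun i => integral_finsetSum (μ := P) Finset.univ fun j _ =>
      (integrable_const (1 : ℝ)).indicator (hm i j),
    fun i j => integral_indicator_const (μ := P) (1 : ℝ) (hm i j),
    fun i j => hc.measureReal_Iic_inter h (by omega : t ≠ t + k) (hcyc i) (hcyc' j) x y,
    hst.integral_cdf_mul h.measurable_latent t k x y]
  have h1 : (q t : ℝ) ≠ 0 := by exact_mod_cast hq0.ne'
  have h2 : (q (t + k) : ℝ) ≠ 0 := by exact_mod_cast hq0'.ne'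
  simp
  field_simp

end Moments

/-! ### Pointwise mean-square rates for the estimated mean and autocovariances. -/

section Rates

theorem abs_sub_le_one {a b : ℝ} (ha : 0 ≤ a) (ha' : a ≤ 1) (hb : 0 ≤ b) (hb' : b ≤ 1) :
    |a - b| ≤ 1 := by
  rw [abs_le]
  constructor <;> linarith

theorem abs_empCdfFun_sub_empMeanFun_le {Ω : Type*} {X : ℝ≥0 → Ω → ℝ} {q : ℕ → ℕ}
    {τ : (t : ℕ) → Fin (q t) → ℝ≥0} (t n : ℕ) (ω : Ω) (x : ℝ) :
    |empCdfFun X q τ t ω x - empMeanFun X q τ n ω x| ≤ 1 :=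
  abs_sub_le_one (empCdfFun_nonneg ..) (empCdfFun_le_one ..) (empMeanFun_nonneg ..)
    (empMeanFun_le_one ..)

theorem abs_empAutoCov_le_one {Ω : Type*} {X : ℝ≥0 → Ω → ℝ} {q : ℕ → ℕ}
    {τ : (t : ℕ) → Fin (q t) → ℝ≥0} (p n : ℕ) (ω : Ω) (k : ℕ) (x y : ℝ) :
    |empAutoCov X q τ p n ω k x y| ≤ 1 := by
  rw [empAutoCov, abs_mul, abs_of_nonneg (by positivity)]
  refine inv_mul_le_one_of_le₀ ((Finset.abs_sum_le_sum_abs _ _).trans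
    ((Finset.sum_le_card_nsmul _ _ 1 fun t _ => ?_).trans (le_of_eq (by simp)))) (by positivity)
  rw [abs_mul]
  exact mul_le_one₀ (abs_empCdfFun_sub_empMeanFun_le ..) (abs_nonneg _)
    (abs_empCdfFun_sub_empMeanFun_le ..)

variable {Ω : Type*} [MeasurableSpace Ω] {P : Measure Ω} {ξ : ℕ → Ω → ProbabilityMeasure ℝ}
  {X : ℝ≥0 → Ω → ℝ} {q : ℕ → ℕ} {τ : (t : ℕ) → Fin (q t) → ℝ≥0}

/-- The mean distribution function `x ↦ 𝔼 F₀(x)`. -/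
noncomputable def meanCdf (P : Measure Ω) (ξ : ℕ → Ω → ProbabilityMeasure ℝ) (x : ℝ) : ℝ :=
  ∫ ω, cdf (ξ 0 ω : Measure ℝ) x ∂P

theorem meanCdf_nonneg (x : ℝ) : 0 ≤ meanCdf P ξ x :=
  integral_nonneg fun _ => cdf_nonneg _ _

variable [IsProbabilityMeasure P]

theorem measurable_meanCdf (hξ : ∀ t, Measurable (ξ t)) : Measurable (meanCdf P ξ) :=
  (StronglyMeasurable.integral_prod_right (f := fun x ω => cdf (ξ 0 ω : Measure ℝ) x)
    (measurable_cdf_uncurry (hξ 0)).stronglyMeasurable).measurable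

theorem meanCdf_le_one (x : ℝ) : meanCdf P ξ x ≤ 1 :=
  (le_abs_self _).trans (abs_integral_le_of_abs_le fun _ => abs_cdf_le_one _ _)

theorem abs_cdf_sub_meanCdf_le (ν : Measure ℝ) (x : ℝ) : |cdf ν x - meanCdf P ξ x| ≤ 1 :=
  abs_sub_le_one (cdf_nonneg _ _) (cdf_le_one _ _) (meanCdf_nonneg _) (meanCdf_le_one _)

theorem abs_empCdfFun_sub_meanCdf_le (t : ℕ) (ω : Ω) (x : ℝ) :
    |empCdfFun X q τ t ω x - meanCdf P ξ x| ≤ 1 :=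
  abs_sub_le_one (empCdfFun_nonneg ..) (empCdfFun_le_one ..) (meanCdf_nonneg _)
    (meanCdf_le_one _)

theorem abs_empMeanFun_sub_meanCdf_le (n : ℕ) (ω : Ω) (x : ℝ) :
    |empMeanFun X q τ n ω x - meanCdf P ξ x| ≤ 1 :=
  abs_sub_le_one (empMeanFun_nonneg ..) (empMeanFun_le_one ..) (meanCdf_nonneg _)
    (meanCdf_le_one _)

theorem integral_sub_mul_sub {U V : Ω → ℝ} (hU : MemLp U 2 P) (hV : MemLp V 2 P) {a b : ℝ}
    (ha : ∫ ω, U ω ∂P = a) (hb : ∫ ω, V ω ∂P = b) :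
    ∫ ω, (U ω - a) * (V ω - b) ∂P = (∫ ω, U ω * V ω ∂P) - a * b := by
  have h := covariance_eq_sub hU hV
  rw [covariance, ha, hb] at h
  exact h

theorem memLp_cdf_left {ζ : Ω → ProbabilityMeasure ℝ} (hζ : Measurable ζ) (x : ℝ) :
    MemLp (fun ω => cdf (ζ ω : Measure ℝ) x) 2 P :=
  memLp_of_abs_le (measurable_cdf_left hζ x) (fun _ => abs_cdf_le_one _ _) 2

theorem memLp_empCdfFun_left (hX : ∀ s, Measurable (X s)) (t : ℕ) (x : ℝ) :
    MemLp (fun ω => empCdfFun X q τ t ω x) 2 P :=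
  memLp_of_abs_le (measurable_empCdfFun_left hX t x) (fun ω => abs_empCdfFun_le_one t ω x) 2

theorem autoCov_eq (hst : IsStationaryLatent P ξ) (hξ : ∀ t, Measurable (ξ t)) (k : ℕ)
    (x y : ℝ) : autoCov P ξ k x y =
      (∫ ω, cdf (ξ 0 ω : Measure ℝ) x * cdf (ξ k ω : Measure ℝ) y ∂P) -
        meanCdf P ξ x * meanCdf P ξ y := by
  rw [autoCov, covariance, hst.integral_cdf hξ k y]
  exact integral_sub_mul_sub (memLp_cdf_left (hξ 0) x) (memLp_cdf_left (hξ k) y) rfl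
    (hst.integral_cdf hξ k y)

theorem abs_autoCov_le_one (hst : IsStationaryLatent P ξ) (hξ : ∀ t, Measurable (ξ t)) (k : ℕ)
    (x y : ℝ) : |autoCov P ξ k x y| ≤ 1 := by
  rw [autoCov, covariance, hst.integral_cdf hξ k y]
  refine abs_integral_le_of_abs_le fun ω => ?_
  rw [abs_mul]
  exact mul_le_one₀ (abs_cdf_sub_meanCdf_le _ x) (abs_nonneg _) (abs_cdf_sub_meanCdf_le _ y)

theorem integral_empCdfFun_sub_mul_sub (h : IsConjugateProcess P ξ X)
    (hst : IsStationaryLatent P ξ) (hc : CyclicIndependent P ξ X) (hq : IsSamplingScheme q τ)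
    {t k : ℕ} (ht : 1 ≤ t) (hk : 1 ≤ k) (x y : ℝ) :
    ∫ ω, (empCdfFun X q τ t ω x - meanCdf P ξ x) *
      (empCdfFun X q τ (t + k) ω y - meanCdf P ξ y) ∂P = autoCov P ξ k x y := by
  rw [integral_sub_mul_sub (a := meanCdf P ξ x) (b := meanCdf P ξ y) (memLp_empCdfFun_left h.measurable_obs t x)
    (memLp_empCdfFun_left h.measurable_obs (t + k) y) (integral_empCdfFun h hst hq ht x)
    (integral_empCdfFun h hst hq (by omega) y), integral_empCdfFun_mul h hst hc hq ht hk,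
    autoCov_eq hst h.measurable_latent]

theorem integral_empMeanFun_sub_sq_le (h : IsConjugateProcess P ξ X)
    (hst : IsStationaryLatent P ξ) (hq : IsSamplingScheme q τ) {μ : Measure ℝ}
    [IsFiniteMeasure μ] {G : ℝ}
    (hG : ∀ N, ∑ k ∈ Finset.range N, truncPsi P (empCdfSigma μ X q τ) k ≤ G) {x : ℝ}
    (hx : IsRightSupported μ x) {n : ℕ} (hn : 0 < n) :
    ∫ ω, (empMeanFun X q τ n ω x - meanCdf P ξ x) ^ 2 ∂P ≤ 8 * G / n := by
  have key := integral_average_sub_sq_le_of_mixing hG 0 (z := meanCdf P ξ x)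
    (fun t => measurable_empCdfFun_left h.measurable_obs t x) (fun t _ =>
      (measurable_empCdfFun_empCdfSigma hx t).mono
        (le_iSup₂ (f := fun s (_ : s ∈ Icc t (t + 0)) => empCdfSigma μ X q τ s) t
          ⟨le_rfl, le_rfl⟩) le_rfl)
    (fun t ω => abs_empCdfFun_le_one t ω x) (fun t ht => integral_empCdfFun h hst hq ht x) hn
  simpa [empMeanFun] using key

/-- Centring at the estimated mean instead of the true one changes each product by two terms, each
an error of the mean times a factor bounded by 1. -/
theorem abs_empAutoCov_sub_average_le {p n : ℕ} (hn : p < n) (ω : Ω) (k : ℕ) (x y : ℝ) :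
    |empAutoCov X q τ p n ω k x y - ((n - p : ℕ) : ℝ)⁻¹ * ∑ t ∈ Finset.Icc 1 (n - p),
      (empCdfFun X q τ t ω x - meanCdf P ξ x) *
        (empCdfFun X q τ (t + k) ω y - meanCdf P ξ y)| ≤
      |empMeanFun X q τ n ω x - meanCdf P ξ x| + |empMeanFun X q τ n ω y - meanCdf P ξ y| := by
  have hN : (0 : ℝ) < ((n - p : ℕ) : ℝ) := by exact_mod_cast Nat.sub_pos_of_lt hn
  rw [empAutoCov, ← mul_sub, ← Finset.sum_sub_distrib, abs_mul, abs_of_pos (inv_pos.2 hN),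
    inv_mul_le_iff₀ hN]
  refine (Finset.abs_sum_le_sum_abs _ _).trans ((Finset.sum_le_card_nsmul _ _
    (|empMeanFun X q τ n ω x - meanCdf P ξ x| + |empMeanFun X q τ n ω y - meanCdf P ξ y|)
    fun t _ => ?_).trans (le_of_eq (by simp [mul_add])))
  have e : (empCdfFun X q τ t ω x - empMeanFun X q τ n ω x) *
      (empCdfFun X q τ (t + k) ω y - empMeanFun X q τ n ω y) -
      (empCdfFun X q τ t ω x - meanCdf P ξ x) *
        (empCdfFun X q τ (t + k) ω y - meanCdf P ξ y) =
      -((empMeanFun X q τ n ω x - meanCdf P ξ x) *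
        (empCdfFun X q τ (t + k) ω y - empMeanFun X q τ n ω y)) +
      -((empCdfFun X q τ t ω x - meanCdf P ξ x) *
        (empMeanFun X q τ n ω y - meanCdf P ξ y)) := by ring
  rw [e]
  refine (abs_add_le _ _).trans (add_le_add ?_ ?_)
  · rw [abs_neg, abs_mul]
    exact mul_le_of_le_one_right (abs_nonneg _) (abs_empCdfFun_sub_empMeanFun_le ..)
  · rw [abs_neg, abs_mul]
    exact mul_le_of_le_one_left (abs_nonneg _) (abs_empCdfFun_sub_meanCdf_le ..)

theorem measurable_empAutoCov_left (hX : ∀ s, Measurable (X s)) (p n k : ℕ) :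
    Measurable fun a : Ω × ℝ × ℝ => empAutoCov X q τ p n a.1 k a.2.1 a.2.2 := by
  have f1 : Measurable fun a : Ω × ℝ × ℝ => (a.2.1, a.1) :=
    (measurable_fst.comp measurable_snd).prodMk measurable_fst
  have f2 : Measurable fun a : Ω × ℝ × ℝ => (a.2.2, a.1) :=
    (measurable_snd.comp measurable_snd).prodMk measurable_fst
  have c1 : ∀ t, Measurable fun a : Ω × ℝ × ℝ => empCdfFun X q τ t a.1 a.2.1 := fun t =>
    (measurable_empCdfFun_uncurry hX t).comp f1
  have c2 : ∀ t, Measurable fun a : Ω × ℝ × ℝ => empCdfFun X q τ t a.1 a.2.2 := fun t =>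
    (measurable_empCdfFun_uncurry hX t).comp f2
  have m1 : Measurable fun a : Ω × ℝ × ℝ => empMeanFun X q τ n a.1 a.2.1 :=
    ((measurable_empMeanFun_uncurry (q := q) (τ := τ) hX n).comp f1 :)
  have m2 : Measurable fun a : Ω × ℝ × ℝ => empMeanFun X q τ n a.1 a.2.2 :=
    ((measurable_empMeanFun_uncurry (q := q) (τ := τ) hX n).comp f2 :)
  unfold empAutoCov
  refine Measurable.const_mul (Finset.measurable_fun_sum _ fun t _ => ?_) _
  exact ((c1 t).sub m1).mul ((c2 (t + k)).sub m2)

theorem integrable_sq_of_abs_le {U : Ω → ℝ} (hU : Measurable U) {c : ℝ}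
    (hc : ∀ ω, |U ω| ≤ c) : Integrable (fun ω => U ω ^ 2) P :=
  (memLp_of_abs_le hU hc 2).integrable_sq

/-- Up to two errors of the mean, the estimate is an average of products centred at the true mean.
These have expectation `C_k` and depend on cycles `t, …, t + k` only, so the mixing bound applies
with window `k`. -/
theorem integral_empAutoCov_sub_sq_le (h : IsConjugateProcess P ξ X)
    (hst : IsStationaryLatent P ξ) (hc : CyclicIndependent P ξ X) (hq : IsSamplingScheme q τ)
    {μ : Measure ℝ} [IsFiniteMeasure μ] {G : ℝ} (hG0 : 0 ≤ G)
    (hG : ∀ N, ∑ k ∈ Finset.range N, truncPsi P (empCdfSigma μ X q τ) k ≤ G) {x y : ℝ}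
    (hx : IsRightSupported μ x) (hy : IsRightSupported μ y) {p n k : ℕ} (hn : p < n)
    (hk : 1 ≤ k) (hkp : k ≤ p) :
    ∫ ω, (empAutoCov X q τ p n ω k x y - autoCov P ξ k x y) ^ 2 ∂P ≤
      (24 * (p + 1) * (p + G) + 48 * G) / n := by
  have hX := h.measurable_obs
  have hn0 : (0 : ℝ) < n := by exact_mod_cast (Nat.zero_le p).trans_lt hn
  have hN : 0 < n - p := Nat.sub_pos_of_lt hn
  have hN' : (0 : ℝ) < ((n - p : ℕ) : ℝ) := by exact_mod_cast hN
  let Z : ℕ → Ω → ℝ := fun t ω => (empCdfFun X q τ t ω x - meanCdf P ξ x) *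
    (empCdfFun X q τ (t + k) ω y - meanCdf P ξ y)
  have hZ : ∀ t, Measurable (Z t) := fun t =>
    ((measurable_empCdfFun_left hX t x).sub_const _).mul
      ((measurable_empCdfFun_left hX (t + k) y).sub_const _)
  have hZ1 : ∀ t ω, |Z t ω| ≤ 1 := fun t ω => by
    rw [abs_mul]
    exact mul_le_one₀ (abs_empCdfFun_sub_meanCdf_le ..) (abs_nonneg _)
      (abs_empCdfFun_sub_meanCdf_le ..)
  have hle : ∀ t s, s ∈ Icc t (t + k) →
      empCdfSigma μ X q τ s ≤ ⨆ r ∈ Icc t (t + k), empCdfSigma μ X q τ r := fun t s hs =>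
    le_iSup₂ (f := fun r (_ : r ∈ Icc t (t + k)) => empCdfSigma μ X q τ r) s hs
  have key := integral_average_sub_sq_le_of_mixing hG k (z := autoCov P ξ k x y) hZ
    (fun t _ => Measurable.mul
      (((measurable_empCdfFun_empCdfSigma hx t).mono
        (hle t t ⟨le_rfl, by omega⟩) le_rfl).sub_const _)
      (((measurable_empCdfFun_empCdfSigma hy (t + k)).mono
        (hle t (t + k) ⟨by omega, le_rfl⟩) le_rfl).sub_const _)) hZ1
    (fun t ht => integral_empCdfFun_sub_mul_sub h hst hc hq ht hk x y) hN
  have kx := integral_empMeanFun_sub_sq_le h hst hq hG hx ((Nat.zero_le p).trans_lt hn)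
  have ky := integral_empMeanFun_sub_sq_le h hst hq hG hy ((Nat.zero_le p).trans_lt hn)
  set A : Ω → ℝ := fun ω => ((n - p : ℕ) : ℝ)⁻¹ * ∑ t ∈ Finset.Icc 1 (n - p), Z t ω with hA
  set ex : Ω → ℝ := fun ω => empMeanFun X q τ n ω x - meanCdf P ξ x with hex
  set ey : Ω → ℝ := fun ω => empMeanFun X q τ n ω y - meanCdf P ξ y with hey
  have hmean : ∀ z, Measurable fun ω => empMeanFun X q τ n ω z - meanCdf P ξ z := fun z =>
    ((measurable_empMeanFun_uncurry hX n).comp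
      (measurable_const.prodMk measurable_id)).sub_const _
  have iex : Integrable (fun ω => ex ω ^ 2) P :=
    integrable_sq_of_abs_le (hmean x) fun ω => abs_empMeanFun_sub_meanCdf_le n ω x
  have iey : Integrable (fun ω => ey ω ^ 2) P :=
    integrable_sq_of_abs_le (hmean y) fun ω => abs_empMeanFun_sub_meanCdf_le n ω y
  have hA1 : ∀ ω, |A ω - autoCov P ξ k x y| ≤ 2 := fun ω => by
    have h1 : |A ω| ≤ 1 := by
      rw [hA, abs_mul, abs_of_pos (inv_pos.2 hN')]
      exact inv_mul_le_one_of_le₀ ((Finset.abs_sum_le_sum_abs _ _).trans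
        ((Finset.sum_le_card_nsmul _ _ 1 fun t _ => hZ1 t ω).trans (le_of_eq (by simp)))) hN'.le
    have := abs_autoCov_le_one hst h.measurable_latent k x y
    exact (abs_sub _ _).trans (by linarith)
  have iA : Integrable (fun ω => (A ω - autoCov P ξ k x y) ^ 2) P :=
    integrable_sq_of_abs_le ((Measurable.const_mul
      (Finset.measurable_fun_sum _ fun t _ => hZ t) _).sub_const _) hA1
  have hpt : ∀ ω, (empAutoCov X q τ p n ω k x y - autoCov P ξ k x y) ^ 2 ≤
      3 * ((A ω - autoCov P ξ k x y) ^ 2 + ex ω ^ 2 + ey ω ^ 2) := fun ω => by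
    have h1 : |empAutoCov X q τ p n ω k x y - A ω| ≤ |ex ω| + |ey ω| :=
      abs_empAutoCov_sub_average_le hn ω k x y
    set a := A ω - autoCov P ξ k x y
    have h2 : |empAutoCov X q τ p n ω k x y - autoCov P ξ k x y| ≤ |a| + (|ex ω| + |ey ω|) := by
      have e : empAutoCov X q τ p n ω k x y - autoCov P ξ k x y =
        a + (empAutoCov X q τ p n ω k x y - A ω) := by ring
      rw [e]
      exact (abs_add_le _ _).trans (by linarith)
    rw [← sq_abs (empAutoCov X q τ p n ω k x y - _), ← sq_abs a, ← sq_abs (ex ω), ← sq_abs (ey ω)]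
    refine (pow_le_pow_left₀ (abs_nonneg _) h2 2).trans ?_
    nlinarith [sq_nonneg (|a| - |ex ω|), sq_nonneg (|a| - |ey ω|), sq_nonneg (|ex ω| - |ey ω|)]
  have iAx : Integrable (fun ω => (A ω - autoCov P ξ k x y) ^ 2 + ex ω ^ 2) P := iA.add iex
  have iAxy : Integrable (fun ω => (A ω - autoCov P ξ k x y) ^ 2 + ex ω ^ 2 + ey ω ^ 2) P :=
    iAx.add iey
  refine (integral_mono_of_nonneg (Eventually.of_forall fun ω => sq_nonneg _)
    (iAxy.const_mul 3) (Eventually.of_forall hpt)).trans ?_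
  rw [integral_const_mul, integral_add iAx iey, integral_add iA iex]
  -- The average has `n - p` terms; for `n > p`, `n ≤ (p + 1)(n - p)` turns the rate into one in `1
  -- / n`.
  have hfrac : 8 * (k + G) / ((n - p : ℕ) : ℝ) ≤ 8 * (p + 1) * (p + G) / n := by
    rw [div_le_div_iff₀ hN' hn0]
    have h1 : (n : ℝ) ≤ (p + 1) * ((n - p : ℕ) : ℝ) := by
      have : n ≤ (p + 1) * (n - p) := by
        obtain ⟨d, rfl⟩ := Nat.exists_eq_add_of_lt hn
        have : p + d + 1 - p = d + 1 := by omega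
        rw [this]
        nlinarith
      exact_mod_cast this
    have h2 : (k : ℝ) ≤ p := by exact_mod_cast hkp
    have h3 : (0 : ℝ) ≤ k := by positivity
    calc 8 * (k + G) * n ≤ 8 * (p + G) * ((p + 1) * ((n - p : ℕ) : ℝ)) := by gcongr
      _ = _ := by ring
  have e : (24 * (p + 1) * (p + G) + 48 * G) / n =
      3 * (8 * (p + 1) * (p + G) / n + 8 * G / n + 8 * G / n) := by ring
  rw [e]
  linarith

end Rates

/-! ### The centred latent cdfs lie on the line of `ψ`. -/

section Degeneracy

variable {Ω : Type*} [MeasurableSpace Ω] {P : Measure Ω} [IsProbabilityMeasure P]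
  {ξ : ℕ → Ω → ProbabilityMeasure ℝ} {μ : Measure ℝ} [IsFiniteMeasure μ]

theorem integrable_bdd_mul_snd {H : Ω → ℝ → ℝ} (hH : Measurable (Function.uncurry H)) {c : ℝ}
    (hc : ∀ ω x, |H ω x| ≤ c) {f : ℝ → ℝ} (hf : Integrable f μ) :
    Integrable (Function.uncurry fun ω x => H ω x * f x) (P.prod μ) :=
  (hf.comp_snd P).bdd_mul (c := c) hH.aestronglyMeasurable
    (Eventually.of_forall fun z => hc z.1 z.2)

theorem memLp_meanCdf (hξ : ∀ t, Measurable (ξ t)) : MemLp (meanCdf P ξ) 2 μ :=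
  MemLp.of_bound (measurable_meanCdf hξ).aestronglyMeasurable 1
    (Eventually.of_forall fun x => by
      rw [Real.norm_eq_abs, abs_of_nonneg (meanCdf_nonneg x)]
      exact meanCdf_le_one x)

/-- The mean distribution function as an element of `L²(μ)`. -/
noncomputable def meanCdfLp (P : Measure Ω) [IsProbabilityMeasure P]
    {ξ : ℕ → Ω → ProbabilityMeasure ℝ} (hξ : ∀ t, Measurable (ξ t)) (μ : Measure ℝ)
    [IsFiniteMeasure μ] : Lp ℝ 2 μ :=
  (memLp_meanCdf (P := P) hξ).toLp _

theorem inner_latentCdf_sub (hξ : ∀ t, Measurable (ξ t)) (t : ℕ) (ω : Ω) (f : Lp ℝ 2 μ) :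
    inner ℝ (latentCdf μ ξ t ω - meanCdfLp P hξ μ) f =
      ∫ x, (cdf (ξ t ω : Measure ℝ) x - meanCdf P ξ x) * f x ∂μ := by
  rw [latentCdf, meanCdfLp, ← MemLp.toLp_sub, inner_toLp]
  rfl

theorem measurable_cdf_sub_meanCdf (hξ : ∀ t, Measurable (ξ t)) (t : ℕ) :
    Measurable (Function.uncurry fun ω x => cdf (ξ t ω : Measure ℝ) x - meanCdf P ξ x) :=
  ((measurable_cdf_uncurry (hξ t)).comp measurable_swap).sub
    ((measurable_meanCdf hξ).comp measurable_snd)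

theorem integral_cdf_sub_mul_sub (hst : IsStationaryLatent P ξ) (hξ : ∀ t, Measurable (ξ t))
    (t : ℕ) (x y : ℝ) :
    ∫ ω, (cdf (ξ t ω : Measure ℝ) x - meanCdf P ξ x) *
      (cdf (ξ t ω : Measure ℝ) y - meanCdf P ξ y) ∂P = autoCov P ξ 0 x y := by
  rw [integral_sub_mul_sub (a := meanCdf P ξ x) (b := meanCdf P ξ y) (memLp_cdf_left (hξ t) x) (memLp_cdf_left (hξ t) y)
    (hst.integral_cdf hξ t x) (hst.integral_cdf hξ t y), autoCov_eq hst hξ]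
  congr 1
  exact hst.integral_cdf_mul hξ t 0 x y

theorem measurable_inner_latentCdf_sub (hξ : ∀ t, Measurable (ξ t)) (t : ℕ) (f : Lp ℝ 2 μ) :
    Measurable fun ω => (inner ℝ (latentCdf μ ξ t ω - meanCdfLp P hξ μ) f : ℝ) := by
  simp_rw [inner_latentCdf_sub]
  have h : StronglyMeasurable (Function.uncurry fun (ω : Ω) (x : ℝ) =>
      (cdf (ξ t ω : Measure ℝ) x - meanCdf P ξ x) * f x) :=
    (measurable_cdf_sub_meanCdf hξ t).stronglyMeasurable.mul
      ((Lp.stronglyMeasurable f).comp_measurable measurable_snd)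
  exact (h.integral_prod_right (ν := μ)).measurable

theorem abs_inner_latentCdf_sub_le (hξ : ∀ t, Measurable (ξ t)) (t : ℕ) (f : Lp ℝ 2 μ) (ω : Ω) :
    |(inner ℝ (latentCdf μ ξ t ω - meanCdfLp P hξ μ) f : ℝ)| ≤ ∫ x, ‖f x‖ ∂μ := by
  rw [inner_latentCdf_sub, ← Real.norm_eq_abs]
  refine norm_integral_le_of_norm_le (Lp.integrable_two f).norm (Eventually.of_forall fun x => ?_)
  rw [norm_mul]
  exact mul_le_of_le_one_left (norm_nonneg _) (abs_cdf_sub_meanCdf_le _ x)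

/-- Write the square as a double integral and move the expectation inside, one Fubini exchange per
factor. -/
theorem integral_sq_integral_mul {a : Ω → ℝ → ℝ} (ha : Measurable (Function.uncurry a))
    (ha1 : ∀ ω x, |a ω x| ≤ 1) {C : ℝ → ℝ → ℝ} (hC : ∀ x y, ∫ ω, a ω x * a ω y ∂P = C x y)
    (f : Lp ℝ 2 μ) :
    ∫ ω, (∫ x, a ω x * f x ∂μ) ^ 2 ∂P = ∫ x, (∫ y, C x y * f y ∂μ) * f x ∂μ := by
  have hf := Lp.integrable_two f
  obtain ⟨g, hga⟩ : ∃ g : Ω → ℝ, ∀ ω, g ω = ∫ x, a ω x * f x ∂μ := ⟨_, fun ω => rfl⟩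
  have hgm : Measurable g := by
    rw [funext hga]
    have h : StronglyMeasurable (Function.uncurry fun (ω : Ω) (x : ℝ) => a ω x * f x) :=
      ha.stronglyMeasurable.mul ((Lp.stronglyMeasurable f).comp_measurable measurable_snd)
    exact (h.integral_prod_right (ν := μ)).measurable
  have hgb : ∀ ω, |g ω| ≤ ∫ x, ‖f x‖ ∂μ := fun ω => by
    rw [hga, ← Real.norm_eq_abs]
    refine norm_integral_le_of_norm_le hf.norm (Eventually.of_forall fun x => ?_)
    rw [norm_mul]
    exact mul_le_of_le_one_left (norm_nonneg _) (ha1 ω x)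
  have hax : ∀ x, Measurable fun ω => a ω x := fun x =>
    ha.comp (measurable_id.prodMk measurable_const)
  have inner_eq : ∀ x, ∫ ω, g ω * a ω x ∂P = ∫ y, C x y * f y ∂μ := fun x => by
    have e1 : ∀ ω, g ω * a ω x = ∫ y, (a ω x * a ω y) * f y ∂μ := fun ω => by
      rw [hga, ← integral_mul_const]
      exact integral_congr_ae (Eventually.of_forall fun y => by simp only; ring)
    simp_rw [e1]
    have hint := integrable_bdd_mul_snd (P := P) (c := 1) (H := fun ω y => a ω x * a ω y)
      (((hax x).comp measurable_fst).mul ha) (fun ω y => by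
        rw [abs_mul]
        exact mul_le_one₀ (ha1 ω x) (abs_nonneg _) (ha1 ω y)) hf
    rw [integral_integral_swap hint]
    refine integral_congr_ae (Eventually.of_forall fun y => ?_)
    simp only
    rw [integral_mul_const, hC x y]
  have e2 : ∀ ω, (∫ x, a ω x * f x ∂μ) ^ 2 = ∫ x, (g ω * a ω x) * f x ∂μ := fun ω => by
    rw [sq, ← hga]
    nth_rewrite 2 [hga]
    rw [← integral_const_mul]
    exact integral_congr_ae (Eventually.of_forall fun y => by simp only; ring)
  simp_rw [e2]
  have hint := integrable_bdd_mul_snd (P := P) (c := (∫ x, ‖f x‖ ∂μ) * 1)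
    (H := fun ω y => g ω * a ω y) ((hgm.comp measurable_fst).mul ha) (fun ω y => by
      rw [abs_mul]
      exact mul_le_mul (hgb ω) (ha1 ω y) (abs_nonneg _)
        (integral_nonneg fun _ => norm_nonneg _)) hf
  rw [integral_integral_swap hint]
  refine integral_congr_ae (Eventually.of_forall fun x => ?_)
  simp only
  rw [integral_mul_const, inner_eq]

theorem integral_inner_latentCdf_sq (hst : IsStationaryLatent P ξ) (hξ : ∀ t, Measurable (ξ t))
    (t : ℕ) (f : Lp ℝ 2 μ) :
    ∫ ω, (inner ℝ (latentCdf μ ξ t ω - meanCdfLp P hξ μ) f : ℝ) ^ 2 ∂P =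
      inner ℝ (covOperator P hξ μ 0 f) f := by
  simp_rw [inner_latentCdf_sub]
  rw [integral_sq_integral_mul (measurable_cdf_sub_meanCdf hξ t)
    (fun ω x => abs_cdf_sub_meanCdf_le _ x) (integral_cdf_sub_mul_sub hst hξ t) f,
    inner_eq_integral_mul]
  refine integral_congr_ae ?_
  filter_upwards [coeFn_integralOperator (isBddKernel_autoCov P hξ 0) f] with x hx
  rw [covOperator, hx]

/-- If the covariance operator has range in the span of `ψ`, so have the centred distribution
functions. -/
theorem ae_latentCdf_sub_eq (hst : IsStationaryLatent P ξ) (hξ : ∀ t, Measurable (ξ t))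
    {ψ : Lp ℝ 2 μ} (hψ : ‖ψ‖ = 1) (hS : ∀ f, ∃ a : ℝ, covOperator P hξ μ 0 f = a • ψ) (t : ℕ) :
    ∀ᵐ ω ∂P, latentCdf μ ξ t ω - meanCdfLp P hξ μ =
      (inner ℝ (latentCdf μ ξ t ω - meanCdfLp P hξ μ) ψ : ℝ) • ψ := by
  have hψψ : inner ℝ ψ ψ = (1 : ℝ) := by rw [real_inner_self_eq_norm_sq, hψ, one_pow]
  have : Fact ((2 : ℝ≥0∞) ≠ ∞) := ⟨by norm_num⟩
  -- For `f ⊥ ψ`, `C₀^μ f` is a multiple of `ψ`, so `⟨F_t - m, f⟩` has zero second moment.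
  have horth : ∀ f : Lp ℝ 2 μ, inner ℝ f ψ = (0 : ℝ) → ∀ᵐ ω ∂P,
      (inner ℝ (latentCdf μ ξ t ω - meanCdfLp P hξ μ) f : ℝ) = 0 := fun f hf => by
    have h0 : inner ℝ (covOperator P hξ μ 0 f) f = (0 : ℝ) := by
      obtain ⟨a, ha⟩ := hS f
      rw [ha, inner_smul_left, real_inner_comm, hf, mul_zero]
    have h1 := integral_inner_latentCdf_sq hst hξ t f
    rw [h0, integral_eq_zero_iff_of_nonneg (fun ω => sq_nonneg _) (integrable_sq_of_abs_le
      (measurable_inner_latentCdf_sub hξ t f) (abs_inner_latentCdf_sub_le hξ t f))] at h1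
    filter_upwards [h1] with ω hω
    exact pow_eq_zero_iff two_ne_zero |>.1 hω
  -- The null set depends on `f`, so countably many `f` are taken: a dense sequence with its
  -- `ψ`-component removed. Continuity then covers all `f` on one event.
  have hd : ∀ i : ℕ, ∀ᵐ ω ∂P, (inner ℝ (latentCdf μ ξ t ω - meanCdfLp P hξ μ)
      (TopologicalSpace.denseSeq (Lp ℝ 2 μ) i -
        (inner ℝ (TopologicalSpace.denseSeq (Lp ℝ 2 μ) i) ψ : ℝ) • ψ) : ℝ) = 0 := fun i =>
    horth _ (by rw [inner_sub_left, inner_smul_left, hψψ]; simp)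
  filter_upwards [ae_all_iff.2 hd] with ω hω
  set D := latentCdf μ ξ t ω - meanCdfLp P hξ μ
  rw [← sub_eq_zero, ← inner_self_eq_zero (𝕜 := ℝ)]
  have hall : ∀ f : Lp ℝ 2 μ, inner ℝ (D - (inner ℝ D ψ : ℝ) • ψ) f = (0 : ℝ) := by
    have hc : IsClosed {f : Lp ℝ 2 μ | inner ℝ (D - (inner ℝ D ψ : ℝ) • ψ) f = (0 : ℝ)} :=
      isClosed_eq (by fun_prop) continuous_const
    intro f
    refine (TopologicalSpace.denseRange_denseSeq (Lp ℝ 2 μ)).induction_on f hc fun i => ?_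
    have h := hω i
    rw [inner_sub_right, inner_smul_right] at h
    rw [inner_sub_left, inner_smul_left, real_inner_comm _ ψ]
    simp only [conj_trivial]
    linarith
  exact hall _

end Degeneracy

/-! ### Finite rank of the estimated operator. -/

section EstimatedOperator

variable {Ω : Type*} {X : ℝ≥0 → Ω → ℝ} {q : ℕ → ℕ} {τ : (t : ℕ) → Fin (q t) → ℝ≥0}
  {μ : Measure ℝ} [IsFiniteMeasure μ]

/-- The finite-dimensional space spanned by the centred empirical distribution functions. -/
def empSpan (μ : Measure ℝ) [IsFiniteMeasure μ] (X : ℝ≥0 → Ω → ℝ) (q : ℕ → ℕ)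
    (τ : (t : ℕ) → Fin (q t) → ℝ≥0) (n : ℕ) (ω : Ω) : Submodule ℝ (Lp ℝ 2 μ) :=
  Submodule.span ℝ ((fun t => empCdf μ X q τ t ω - empMean μ X q τ n ω) '' (Finset.Icc 1 n : Set ℕ))

instance (n : ℕ) (ω : Ω) : FiniteDimensional ℝ (empSpan μ X q τ n ω) :=
  FiniteDimensional.span_of_finite ℝ ((Finset.finite_toSet _).image _)

/-- The kernel is a finite sum of products of a function of `x` and one of `y`, so the image is a
combination of the functions of `x`. -/
theorem integralOperator_empAutoCov_mem (p n : ℕ) (ω : Ω) (k : ℕ) (f : Lp ℝ 2 μ) :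
    integralOperator μ _ (isBddKernel_empAutoCov X q τ p n ω k) f ∈ empSpan μ X q τ n ω := by
  set u : ℕ → Lp ℝ 2 μ := fun t => empCdf μ X q τ t ω - empMean μ X q τ n ω with hu
  let c : ℕ → ℝ := fun t => ((n - p : ℕ) : ℝ)⁻¹ *
    ∫ y, (empCdfFun X q τ (t + k) ω y - empMeanFun X q τ n ω y) * f y ∂μ
  have e : integralOperator μ _ (isBddKernel_empAutoCov X q τ p n ω k) f =
      ∑ t ∈ Finset.Icc 1 (n - p), c t • u t := by
    refine Lp.ext ?_
    have h1 : ∀ t, ∀ᵐ x ∂μ, (c t • u t : Lp ℝ 2 μ) x =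
        c t * (empCdfFun X q τ t ω x - empMeanFun X q τ n ω x) := fun t => by
      filter_upwards [Lp.coeFn_smul (c t) (u t),
        Lp.coeFn_sub (empCdf μ X q τ t ω) (empMean μ X q τ n ω),
        (memLp_empCdfFun μ X q τ t ω).coeFn_toLp,
        (memLp_empMeanFun μ X q τ n ω).coeFn_toLp] with x a1 a2 a3 a4
      rw [a1, Pi.smul_apply, smul_eq_mul, hu, a2, Pi.sub_apply, empCdf, a3, empMean, a4]
    filter_upwards [coeFn_integralOperator (isBddKernel_empAutoCov X q τ p n ω k) f,
      Lp.coeFn_finsetSum (Finset.Icc 1 (n - p)) fun t => c t • u t, ae_all_iff.2 h1]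
      with x b1 b2 b3
    rw [b1, b2, Finset.sum_apply]
    simp_rw [b3]
    have hint : ∀ t, Integrable (fun y =>
        (empCdfFun X q τ (t + k) ω y - empMeanFun X q τ n ω y) * f y) μ := fun t =>
      MemLp.integrable_mul ((memLp_empCdfFun μ X q τ (t + k) ω).sub
        (memLp_empMeanFun μ X q τ n ω)) (Lp.memLp f)
    have e1 : ∀ y, empAutoCov X q τ p n ω k x y * f y = ∑ t ∈ Finset.Icc 1 (n - p),
        (((n - p : ℕ) : ℝ)⁻¹ * (empCdfFun X q τ t ω x - empMeanFun X q τ n ω x)) *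
          ((empCdfFun X q τ (t + k) ω y - empMeanFun X q τ n ω y) * f y) := fun y => by
      rw [empAutoCov, Finset.mul_sum, Finset.sum_mul]
      exact Finset.sum_congr rfl fun t _ => by ring
    simp_rw [e1]
    rw [integral_finsetSum _ fun t _ => (hint t).const_mul _]
    refine Finset.sum_congr rfl fun t _ => ?_
    rw [integral_const_mul]
    ring
  rw [e]
  refine Submodule.sum_mem _ fun t ht => Submodule.smul_mem _ _ (Submodule.subset_span ⟨t, ?_, rfl⟩)
  have := Finset.mem_Icc.1 ht
  exact Finset.mem_coe.2 (Finset.mem_Icc.2 ⟨this.1, by omega⟩)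

theorem RhatOperator_mem (p n : ℕ) (ω : Ω) (f : Lp ℝ 2 μ) :
    RhatOperator μ X q τ p n ω f ∈ empSpan μ X q τ n ω := by
  rw [RhatOperator, integralOperator_sumKernel p (isBddKernel_empAutoCov X q τ p n ω)]
  exact Submodule.sum_mem _ fun k _ => integralOperator_empAutoCov_mem p n ω k _

end EstimatedOperator

/-! ### From pointwise rates to mean-square rates in `L²`. -/

section MeanSquare

variable {Ω : Type*} [MeasurableSpace Ω] {P : Measure Ω} [IsProbabilityMeasure P]
  {ξ : ℕ → Ω → ProbabilityMeasure ℝ}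
  {X : ℝ≥0 → Ω → ℝ} {q : ℕ → ℕ} {τ : (t : ℕ) → Fin (q t) → ℝ≥0}
  {μ : Measure ℝ} [IsFiniteMeasure μ]

/-- If `D` is bounded and jointly measurable and `𝔼 D(·, z)² ≤ c` for almost all `z`, then
`z ↦ D(·, z)` has mean square at most `c ν(E)`. -/
theorem integral_integral_sq_le {E : Type*} [MeasurableSpace E] {ν : Measure E}
    [IsFiniteMeasure ν] {D : Ω → E → ℝ} (hD : Measurable (Function.uncurry D)) {b c : ℝ}
    (hb : ∀ ω z, |D ω z| ≤ b) (hc : ∀ᵐ z ∂ν, ∫ ω, D ω z ^ 2 ∂P ≤ c) :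
    Integrable (fun ω => ∫ z, D ω z ^ 2 ∂ν) P ∧
      ∫ ω, ∫ z, D ω z ^ 2 ∂ν ∂P ≤ c * ν.real univ := by
  have hint : Integrable (Function.uncurry fun ω z => D ω z ^ 2) (P.prod ν) :=
    Integrable.of_bound (C := b ^ 2) (hD.pow_const 2).aestronglyMeasurable
      (Eventually.of_forall fun z => by
        simp only [Function.uncurry, norm_pow, Real.norm_eq_abs]
        exact pow_le_pow_left₀ (abs_nonneg _) (hb _ _) 2)
  refine ⟨hint.integral_prod_left, ?_⟩
  rw [integral_integral_swap hint]
  refine (Real.le_norm_self _).trans (norm_integral_le_of_norm_le_const ?_)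
  filter_upwards [hc] with z hz
  rwa [Real.norm_eq_abs, abs_of_nonneg (integral_nonneg fun ω => sq_nonneg _)]

theorem norm_empMean_sub_sq (hξ : ∀ t, Measurable (ξ t)) (n : ℕ) (ω : Ω) :
    ‖empMean μ X q τ n ω - meanCdfLp P hξ μ‖ ^ 2 =
      ∫ x, (empMeanFun X q τ n ω x - meanCdf P ξ x) ^ 2 ∂μ := by
  rw [empMean, meanCdfLp, ← MemLp.toLp_sub, norm_toLp_sq]
  rfl

/-- Deterministic and independent of `t`: this makes the final bound uniform over `1 ≤ t ≤ n`. -/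
theorem norm_empCdf_sub_le (hξ : ∀ t, Measurable (ξ t)) (t : ℕ) (ω : Ω) :
    ‖empCdf μ X q τ t ω - meanCdfLp P hξ μ‖ ≤ √(μ.real univ) := by
  refine Real.le_sqrt_of_sq_le ?_
  rw [empCdf, meanCdfLp, ← MemLp.toLp_sub, norm_toLp_sq]
  refine (Real.le_norm_self _).trans ((norm_integral_le_of_norm_le_const (C := 1)
    (Eventually.of_forall fun x => ?_)).trans (le_of_eq (one_mul _)))
  rw [norm_pow, Real.norm_eq_abs]
  exact pow_le_one₀ (abs_nonneg _) (abs_empCdfFun_sub_meanCdf_le t ω x)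

theorem abs_empAutoCov_sub_autoCov_le (hst : IsStationaryLatent P ξ)
    (hξ : ∀ t, Measurable (ξ t)) (p n : ℕ) (ω : Ω) (k : ℕ) (x y : ℝ) :
    |empAutoCov X q τ p n ω k x y - autoCov P ξ k x y| ≤ 2 :=
  (abs_sub _ _).trans ((add_le_add (abs_empAutoCov_le_one p n ω k x y)
    (abs_autoCov_le_one hst hξ k x y)).trans (by norm_num))

theorem hsNorm_sq {K : ℝ → ℝ → ℝ} (hK : IsBddKernel K) :
    hsNorm μ K ^ 2 = ∫ z, K z.1 z.2 ^ 2 ∂(μ.prod μ) := by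
  obtain ⟨hm, c, hc⟩ := hK
  rw [hsNorm, Real.sq_sqrt (integral_nonneg fun x => integral_nonneg fun y => sq_nonneg _)]
  refine (integral_prod (fun z : ℝ × ℝ => K z.1 z.2 ^ 2) ?_).symm
  refine Integrable.of_bound (C := c ^ 2) (hm.pow_const 2).aestronglyMeasurable
    (Eventually.of_forall fun z => ?_)
  rw [norm_pow, Real.norm_eq_abs]
  exact pow_le_pow_left₀ (abs_nonneg _) (hc _ _) 2

/-- The squared estimation error of the mean and of the autocovariance kernels. -/
noncomputable def estError (P : Measure Ω) [IsProbabilityMeasure P]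
    {ξ : ℕ → Ω → ProbabilityMeasure ℝ} (hξ : ∀ t, Measurable (ξ t)) (μ : Measure ℝ)
    [IsFiniteMeasure μ] (X : ℝ≥0 → Ω → ℝ) (q : ℕ → ℕ) (τ : (t : ℕ) → Fin (q t) → ℝ≥0)
    (p n : ℕ) (ω : Ω) : ℝ :=
  ‖empMean μ X q τ n ω - meanCdfLp P hξ μ‖ ^ 2 + ∑ k ∈ Finset.Icc 1 p,
    hsNorm μ (fun x y => empAutoCov X q τ p n ω k x y - autoCov P ξ k x y) ^ 2

theorem estError_nonneg (hξ : ∀ t, Measurable (ξ t)) (p n : ℕ) (ω : Ω) :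
    0 ≤ estError P hξ μ X q τ p n ω :=
  add_nonneg (sq_nonneg _) (Finset.sum_nonneg fun _ _ => sq_nonneg _)

/-- The pointwise rates hold at almost every point, hence at `μ ⊗ μ`-almost every pair, with
constants independent of the point; Fubini integrates them. -/
theorem integral_estError_le (h : IsConjugateProcess P ξ X) (hst : IsStationaryLatent P ξ)
    (hc : CyclicIndependent P ξ X) (hμ : IsDiffraction P ξ μ) (hq : IsSamplingScheme q τ)
    (hmix : ∑' k : ℕ, (k : ℝ≥0∞) * psiCoeff P (empCdfSigma μ X q τ) k ^ (1 / 2 : ℝ) < ∞)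
    (p : ℕ) : ∃ c : ℝ, 0 ≤ c ∧ ∀ n, p < n →
      Integrable (estError P h.measurable_latent μ X q τ p n) P ∧
        ∫ ω, estError P h.measurable_latent μ X q τ p n ω ∂P ≤ c / n := by
  obtain ⟨G, hG0, hG⟩ := exists_sum_truncPsi_le hmix
  have hX := h.measurable_obs
  have hξ := h.measurable_latent
  set c' : ℝ := 24 * (p + 1) * (p + G) + 48 * G
  refine ⟨8 * G * μ.real univ + p * (c' * (μ.prod μ).real univ), by positivity, fun n hn => ?_⟩
  have hn0 : 0 < n := (Nat.zero_le p).trans_lt hn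
  have hsupp := hμ.ae_isRightSupported
  obtain ⟨i1, b1⟩ := integral_integral_sq_le (P := P) (ν := μ) (c := 8 * G / n)
    (D := fun ω x => empMeanFun X q τ n ω x - meanCdf P ξ x)
    (((measurable_empMeanFun_uncurry (q := q) (τ := τ) hX n).comp measurable_swap).sub
      ((measurable_meanCdf hξ).comp measurable_snd))
    (fun ω x => abs_empMeanFun_sub_meanCdf_le n ω x)
    (hsupp.mono fun x hx => integral_empMeanFun_sub_sq_le h hst hq hG hx hn0)
  have hprod : ∀ᵐ z ∂(μ.prod μ), IsRightSupported μ z.1 ∧ IsRightSupported μ z.2 :=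
    (Measure.quasiMeasurePreserving_fst.ae hsupp).and (Measure.quasiMeasurePreserving_snd.ae hsupp)
  have hk : ∀ k ∈ Finset.Icc 1 p, _ := fun k hk =>
    integral_integral_sq_le (P := P) (ν := μ.prod μ) (c := c' / n)
      (D := fun ω z => empAutoCov X q τ p n ω k z.1 z.2 - autoCov P ξ k z.1 z.2)
      ((measurable_empAutoCov_left hX p n k).sub
        ((isBddKernel_autoCov P hξ k).1.comp measurable_snd))
      (fun ω z => abs_empAutoCov_sub_autoCov_le hst hξ p n ω k z.1 z.2)
      (hprod.mono fun z hz => integral_empAutoCov_sub_sq_le h hst hc hq hG0 hG hz.1 hz.2 hn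
        (Finset.mem_Icc.1 hk).1 (Finset.mem_Icc.1 hk).2)
  have e : estError P hξ μ X q τ p n = fun ω =>
      (∫ x, (empMeanFun X q τ n ω x - meanCdf P ξ x) ^ 2 ∂μ) + ∑ k ∈ Finset.Icc 1 p,
        ∫ z, (empAutoCov X q τ p n ω k z.1 z.2 - autoCov P ξ k z.1 z.2) ^ 2 ∂(μ.prod μ) := by
    funext ω
    rw [estError, norm_empMean_sub_sq]
    congr 1
    exact Finset.sum_congr rfl fun k _ => hsNorm_sq
      ((isBddKernel_empAutoCov X q τ p n ω k).sub (isBddKernel_autoCov P hξ k))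
  have i2 : Integrable (fun ω => ∑ k ∈ Finset.Icc 1 p,
      ∫ z, (empAutoCov X q τ p n ω k z.1 z.2 - autoCov P ξ k z.1 z.2) ^ 2 ∂(μ.prod μ)) P :=
    integrable_finsetSum _ fun k hk' => (hk k hk').1
  rw [e]
  refine ⟨i1.add i2, ?_⟩
  rw [integral_add i1 i2, integral_finsetSum _ fun k hk' => (hk k hk').1]
  refine (add_le_add b1 (Finset.sum_le_sum fun k hk' => (hk k hk').2)).trans (le_of_eq ?_)
  simp only [Finset.sum_const, Nat.card_Icc, add_tsub_cancel_right, nsmul_eq_mul]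
  ring

end MeanSquare

/-! ### Deterministic error bound for the estimator. -/

section Estimator

variable {Ω : Type*} [MeasurableSpace Ω] {P : Measure Ω} [IsProbabilityMeasure P]
  {ξ : ℕ → Ω → ProbabilityMeasure ℝ}
  {X : ℝ≥0 → Ω → ℝ} {q : ℕ → ℕ} {τ : (t : ℕ) → Fin (q t) → ℝ≥0}
  {μ : Measure ℝ} [IsFiniteMeasure μ]

/-- Deterministic bound for the error of the estimator in terms of the estimation errors of the
mean and of the autocovariance kernels. -/
theorem norm_Ftilde_sub_le (hst : IsStationaryLatent P ξ) (hξ : ∀ t, Measurable (ξ t))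
    {p n t : ℕ} {ω : Ω} {ψ φ : Lp ℝ 2 μ} (hψ : ‖ψ‖ = 1) {θ : ℝ} (hθ : 0 < θ)
    (hR : ∀ f, ROperator P hξ μ p f = (θ * inner ℝ f ψ) • ψ)
    (hφ : IsLeadingEigenfunction (RhatOperator μ X q τ p n ω) φ)
    (hF : latentCdf μ ξ t ω - meanCdfLp P hξ μ =
      (inner ℝ (latentCdf μ ξ t ω - meanCdfLp P hξ μ) ψ : ℝ) • ψ) {r : ℝ}
    (hr : estError P hξ μ X q τ p n ω ≤ r) :
    ‖Ftilde μ X q τ n φ t ω -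
      (latentCdf μ ξ t ω + (inner ℝ (noise μ ξ X q τ t ω) ψ : ℝ) • ψ)‖ ≤
      (2 + 16 * μ.real univ * p / θ * √(μ.real univ)) * √r := by
  obtain ⟨hφ1, θ', hθ', hmax⟩ := hφ
  have hsum : 0 ≤ ∑ k ∈ Finset.Icc 1 p,
      hsNorm μ (fun x y => empAutoCov X q τ p n ω k x y - autoCov P ξ k x y) ^ 2 :=
    Finset.sum_nonneg fun k _ => sq_nonneg _
  have hm : ‖empMean μ X q τ n ω - meanCdfLp P hξ μ‖ ≤ √r :=
    Real.le_sqrt_of_sq_le (by unfold estError at hr; linarith)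
  have hk : ∀ k ∈ Finset.Icc 1 p,
      hsNorm μ (fun x y => empAutoCov X q τ p n ω k x y - autoCov P ξ k x y) ≤ √r := fun k hk => by
    refine Real.le_sqrt_of_sq_le (le_trans ?_ hr)
    have h1 := Finset.single_le_sum (f := fun k =>
      hsNorm μ (fun x y => empAutoCov X q τ p n ω k x y - autoCov P ξ k x y) ^ 2)
      (fun k _ => sq_nonneg _) hk
    exact h1.trans (le_add_of_nonneg_left (sq_nonneg _))
  have hδ : ∀ f, ‖RhatOperator μ X q τ p n ω f - ROperator P hξ μ p f‖ ≤
      2 * μ.real univ * (p * √r) * ‖f‖ := fun f => by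
    refine (norm_sumKernel_sub_le p (isBddKernel_empAutoCov X q τ p n ω)
      (isBddKernel_autoCov P hξ) (abs_empAutoCov_le_one p n ω) (abs_autoCov_le_one hst hξ) f).trans ?_
    refine mul_le_mul_of_nonneg_right (mul_le_mul_of_nonneg_left ?_ (by positivity))
      (norm_nonneg f)
    exact (Finset.sum_le_card_nsmul _ _ _ hk).trans (le_of_eq (by simp))
  have hb := norm_le_of_eigenvector_of_perturbation
    (sumKernel_symmetric p (isBddKernel_empAutoCov X q τ p n ω)) (RhatOperator_mem p n ω) hθ hψ hR
    hδ hφ1 hθ' hmax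
  have hproj := norm_projection_sub_le hψ hφ1 (empCdf μ X q τ t ω - meanCdfLp P hξ μ)
  have hin : ‖(inner ℝ (empMean μ X q τ n ω - meanCdfLp P hξ μ) φ : ℝ) • φ‖ ≤ √r := by
    rw [norm_smul, hφ1, mul_one]
    refine (abs_real_inner_le_norm _ _).trans ?_
    rwa [hφ1, mul_one]
  -- Here the degeneracy `hF` enters: it rewrites the target as `m + ⟨F̂_t - m,ψ⟩ψ`, so that only
  -- the error of the mean and a difference of projections remain. The former gives the 2 in the
  -- constant; the latter gives `16 = 4 · 2 · 2`, from the projection bound, the eigenvector bound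
  -- and the operator bound.
  have e : Ftilde μ X q τ n φ t ω -
      (latentCdf μ ξ t ω + (inner ℝ (noise μ ξ X q τ t ω) ψ : ℝ) • ψ) =
      (empMean μ X q τ n ω - meanCdfLp P hξ μ) -
        (inner ℝ (empMean μ X q τ n ω - meanCdfLp P hξ μ) φ : ℝ) • φ +
      ((inner ℝ (empCdf μ X q τ t ω - meanCdfLp P hξ μ) φ : ℝ) • φ -
        (inner ℝ (empCdf μ X q τ t ω - meanCdfLp P hξ μ) ψ : ℝ) • ψ) := by
    have hL : latentCdf μ ξ t ω = meanCdfLp P hξ μ +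
        (inner ℝ (latentCdf μ ξ t ω - meanCdfLp P hξ μ) ψ : ℝ) • ψ := by rw [← hF]; abel
    rw [Ftilde, What, noise]
    nth_rewrite 1 [hL]
    simp only [inner_sub_left]
    module
  rw [e]
  refine (norm_add_le_of_le (norm_sub_le_of_le hm hin) hproj).trans ?_
  have hB := norm_empCdf_sub_le (P := P) (μ := μ) (X := X) (q := q) (τ := τ) hξ t ω
  have h2 := mul_le_mul (mul_le_mul_of_nonneg_left hb (by norm_num : (0 : ℝ) ≤ 4)) hB
    (norm_nonneg _) (by positivity)
  refine (add_le_add_right h2 _).trans (le_of_eq ?_)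
  ring

end Estimator

end ConjProc

/-! ### Conclusion by Markov's inequality. -/

theorem mainTheorem10
    {Ω : Type*} [MeasurableSpace Ω] (P : Measure Ω) [IsProbabilityMeasure P]
    -- a stationary, cyclic-independent, ergodic conjugate process and a diffraction of it
    (ξ : ℕ → Ω → ProbabilityMeasure ℝ) (X : ℝ≥0 → Ω → ℝ)
    (hconj : IsConjugateProcess P ξ X)
    (hstat : IsStationaryLatent P ξ)
    (hcyc : CyclicIndependent P ξ X)
    (herg : IsErgodicInProbability P ξ)
    (μ : Measure ℝ) [IsFiniteMeasure μ] (hμ : IsDiffraction P ξ μ)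
    -- the sampling scheme, with mixing empirical cdfs
    (q : ℕ → ℕ) (τ : (t : ℕ) → Fin (q t) → ℝ≥0) (hsamp : IsSamplingScheme q τ)
    (hmix : IsPsiMixing P (empCdfSigma μ X q τ))
    (hmixsum : ∑' k : ℕ, (k : ℝ≥0∞) *
      psiCoeff P (empCdfSigma μ X q τ) k ^ (1 / 2 : ℝ) < ∞)
    -- range equivalence, and `d = 1`
    (p : ℕ) (hp : 1 ≤ p)
    (hR : RangeEquivalent (ROperator P hconj.measurable_latent μ p)
      (covOperator P hconj.measurable_latent μ 0))
    (hd : LinearMap.rank (covOperator P hconj.measurable_latent μ 0) = 1)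
    -- the leading eigenfunctions of `R^μ` and, for every `n > p`, of its estimator
    (ψ : Lp ℝ 2 μ)
    (hψ : IsLeadingEigenfunction (ROperator P hconj.measurable_latent μ p) ψ)
    (ψhat : ℕ → Ω → Lp ℝ 2 μ)
    (hψhat : ∀ n, p < n → ∀ ω,
      IsLeadingEigenfunction (RhatOperator μ X q τ p n ω) (ψhat n ω)) :
    ∀ ε : ℝ, 0 < ε → ∃ M : ℝ, ∃ N : ℕ, ∀ n : ℕ, N ≤ n → ∀ t : ℕ, 1 ≤ t → t ≤ n →
      P {ω | M < √(n : ℝ) *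
        ‖Ftilde μ X q τ n (ψhat n ω) t ω -
          (latentCdf μ ξ t ω + (inner ℝ (noise μ ξ X q τ t ω) ψ : ℝ) • ψ)‖}
        ≤ ENNReal.ofReal ε := by
  intro ε hε
  have hξ := hconj.measurable_latent
  obtain ⟨hψ1, θ, hθ, hmax⟩ := hψ
  obtain ⟨hθ0, hRψ, hS⟩ := eq_smul_of_rank_one
    (sumKernel_symmetric p fun k => isBddKernel_autoCov P hξ k)
    (inner_sumKernel_self_nonneg p fun k => isBddKernel_autoCov P hξ k) hd hR hψ1 hθ hmax
  obtain ⟨c, hc0, hc⟩ := integral_estError_le hconj hstat hcyc hμ hsamp hmixsum p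
  -- Markov gives `K · P(estError ≥ K/n) ≤ c < K ε`; using `c + 1` instead of `c` also makes `K`
  -- positive when `c = 0`.
  obtain ⟨K, hK0, hK⟩ : ∃ K : ℝ, 0 < K ∧ K * ε = c + 1 :=
    ⟨(c + 1) / ε, by positivity, div_mul_cancel₀ _ hε.ne'⟩
  refine ⟨(2 + 16 * μ.real univ * p / θ * √(μ.real univ)) * √K, p + 1, fun n hn t _ _ => ?_⟩
  have hpn : p < n := hn
  have hn0 : (0 : ℝ) < n := by exact_mod_cast (Nat.zero_le p).trans_lt hpn
  obtain ⟨hint, hle⟩ := hc n hpn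
  have hmarkov : P.real {ω | K / n ≤ estError P hξ μ X q τ p n ω} ≤ ε := by
    have h1 := (mul_meas_ge_le_integral_of_nonneg
      (Eventually.of_forall (estError_nonneg hξ p n)) hint (K / n)).trans hle
    rw [div_mul_eq_mul_div, div_le_div_iff_of_pos_right hn0] at h1
    by_contra! hlt
    nlinarith [mul_lt_mul_of_pos_left hlt hK0]
  -- The choice of `ψhat` need not be measurable in `ω`; its event is only shown to lie, up to a
  -- null set, in the event of a large estimation error.
  refine le_trans (measure_mono_ae ?_) ((ENNReal.le_ofReal_iff_toReal_le
    (measure_ne_top P _) hε.le).2 hmarkov)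
  filter_upwards [ae_latentCdf_sub_eq hstat hξ hψ1 hS t] with ω hF hM
  by_contra hlt
  have hr : estError P hξ μ X q τ p n ω ≤ K / n := le_of_not_ge hlt
  have key := norm_Ftilde_sub_le hstat hξ hψ1 hθ0 hRψ (hψhat n hpn ω) hF hr
  refine absurd hM (not_lt.2 ((mul_le_mul_of_nonneg_left key (Real.sqrt_nonneg _)).trans
    (le_of_eq ?_)))
  rw [Real.sqrt_div hK0.le]
  have : √(n : ℝ) ≠ 0 := (Real.sqrt_pos.2 hn0).ne'
  field_simp
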